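/- **Setting.** Let $\mathbb F_2$ be the field with two elements and $\delta\in[0,1]$. For $n$ independent qubit erasure channels with parameter $\delta$, each of which acts on a qubit state by $$\rho\mapsto(1-\delta)\,\rho\otimes|0\rangle\langle 0|+\tfrac{\delta}{4}\left(\rho+X\rho X+Z\rho Z+XZ\rho ZX\right)\otimes|1\rangle\langle 1|,$$ let $p_{UV}$ be the joint distribution of the Pauli error $U\in\mathbb F_2^{2n}$ and the vector of erasure flags $V\in\mathbb F_2^{n}$. (For each qubit $i$, coordinate $i$ of $U$ is the exponent of $X$ and coordinate $2n+1-i$ is the exponent of $Z$. Independently for each qubit, with probability $1-\delta$ the flag is $0$ and both exponents are $0$; with probability $\delta$ the flag is $1$ and the two exponents are uniformly distributed.) For each $v$ list the vectors of $\mathbb F_2^{2n}$ in decreasing order of $p_{UV}(\cdot,v)$, with ties resolved arbitrarily, and let $J\in\{1,\dots,2^{2n}\}$ be the position of $U$ in the list for $V$. For $0\le k\le n$, $m=n-k$ and $r=k/n$, put $$\varepsilon_{\mathrm{conv}}(r)=\Pr[J>2^m],\qquad \varepsilon_{\mathrm{ach}}(r)=\Pr[J>2^m]+\mathbb E\left[1_{\{J\le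 2^m\}}(J-1)2^{-m}\right].$$ Let $T$ be the $2n\times 2n$ matrix over $\mathbb F_2$ with ones exactly on the reverse diagonal. For $\epsilon\in(0,1)$ let $R(p_{UV},\epsilon)$ be the maximum of $k/n$ over all $0\le k\le n$ for which there are a matrix $C$ over $\mathbb F_2$ with $C^{\top}TC=T$ and a decoder $D$ such that $\Pr[D(V,S)\ne U]\le\epsilon$, where $S\in\mathbb F_2^{m}$, $m=n-k$, consists of the first $m$ coordinates of $CU$. Let $F(n,p,i)=\sum_{i'=0}^{i}\binom{n}{i'}p^{i'}(1-p)^{n-i'}$ and $\Phi(x)=\frac{1}{\sqrt{2\pi}}\int_{-\infty}^{x}e^{-t^2/2}\,dt$. **Theorem.** For all $n$, all $0\le k\le n$, $m=n-k$, $r=k/n$, $$\varepsilon_{\mathrm{conv}}(r)=F\left(n,1-\delta,n-\lfloor\tfrac m2\rfloor-1\right)-2^m\left(\tfrac{4-3\delta}{4}\right)^{n}F\left(n,\tfrac{4-4\delta}{4-3\delta},n-\lfloor\tfrac m2\rfloor-1\right)$$ and $$\begin{aligned}\varepsilon_{\mathrm{ach}}(r)={}&\left(1+\tfrac{1}{2^{m+1}}\right)F\left(n,1-\delta,n-\lfloor\tfrac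 m2\rfloor-1\right)-\tfrac{1}{2^{m+1}}\\&-\tfrac{2^m+1}{2}\left(\tfrac{4-3\delta}{4}\right)^{n}F\left(n,\tfrac{4-4\delta}{4-3\delta},n-\lfloor\tfrac m2\rfloor-1\right)+\tfrac{(1+3\delta)^n}{2^{m+1}}F\left(n,\tfrac{4\delta}{1+3\delta},\lfloor\tfrac m2\rfloor\right).\end{aligned}$$ Moreover, let $\epsilon\in(0,1)$ be fixed, and suppose that $\delta<\tfrac12$, or that $\delta=\tfrac12$ and $\epsilon\ge\tfrac12$. Then for all sufficiently large $n$ the maximum $R(p_{UV},\epsilon)$ exists, and as $n\to\infty$ $$R(p_{UV},\epsilon)=1-2\delta+\frac{2\,\Phi^{-1}(\epsilon)\sqrt{\delta(1-\delta)}}{\sqrt n}+O\left(\frac1n\right),$$ where the implied constant may depend on $\delta$ and $\epsilon$. -/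

import Mathlib

open Filter Asymptotics
open scoped Kronecker

/-- Vectors in `𝔽₂^{2n}`; they label the `n`-qubit Pauli errors. -/
abbrev PauliVec (n : ℕ) : Type := Fin (2 * n) → ZMod 2

/-- The coordinate of `u` giving the power of `X` on qubit `i` (the `i`-th coordinate). -/
def PauliVec.xPart {n : ℕ} (u : PauliVec n) (i : Fin n) : ZMod 2 :=
  u (Fin.castLE (by omega) i)

/-- The coordinate of `u` giving the power of `Z` on qubit `i`. The generators are ordered
`X₁, …, Xₙ, Zₙ, …, Z₁`, so this is the `i`-th coordinate from the end. -/
def PauliVec.zPart {n : ℕ} (u : PauliVec n) (i : Fin n) : ZMod 2 :=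
  u (Fin.rev (Fin.castLE (by omega) i))

/-- The joint distribution `p_{UV}` of a Pauli error `U` in `𝔽₂^{2n}` and of classical side
information `V` with finitely many values. -/
structure PauliNoise (n : ℕ) (V : Type*) [Fintype V] where
  /-- `mass u v` is the probability that `U = u` and `V = v`. -/
  mass : PauliVec n → V → ℝ
  mass_nonneg : ∀ u v, 0 ≤ mass u v
  sum_mass : ∑ u, ∑ v, mass u v = 1

namespace PauliNoise

variable {n : ℕ} {V : Type*} [Fintype V]

open Classical in
/-- The probability of the event `E(U, V)`. -/
noncomputable def probOf (p : PauliNoise n V) (E : PauliVec n → V → Prop) : ℝ :=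
  ∑ u, ∑ v, if E u v then p.mass u v else 0

/-- The expectation of `f(U, V)`. -/
noncomputable def expect (p : PauliNoise n V) (f : PauliVec n → V → ℝ) : ℝ :=
  ∑ u, ∑ v, p.mass u v * f u v

end PauliNoise

/-! ### Symplectic matrices, syndromes, guessing the error -/

/-- The matrix with ones on the reverse diagonal. -/
def revDiag (N : ℕ) : Matrix (Fin N) (Fin N) (ZMod 2) :=
  Matrix.of fun i j => if j = Fin.rev i then 1 else 0

/-- The symplectic matrices: those that preserve the form `xᵀ R y`, `R` the reverse diagonal. -/
def symplecticMatrices (n : ℕ) : Set (Matrix (Fin (2 * n)) (Fin (2 * n)) (ZMod 2)) :=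
  {C | C.transpose * revDiag (2 * n) * C = revDiag (2 * n)}

/-- The syndrome of `u`: the first `m = n - k` coordinates of `C u`. -/
def syndrome {n : ℕ} (k : ℕ) (C : Matrix (Fin (2 * n)) (Fin (2 * n)) (ZMod 2))
    (u : PauliVec n) : Fin (n - k) → ZMod 2 :=
  fun i => C.mulVec u (Fin.castLE (by omega) i)

namespace PauliNoise

variable {n : ℕ} {V : Type*} [Fintype V]

/-- The probability that the decoder `D`, given the side information and the `m = n - k` bits
of syndrome, guesses the error `U` incorrectly. -/
noncomputable def wrongGuessProb (p : PauliNoise n V) (k : ℕ)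
    (C : Matrix (Fin (2 * n)) (Fin (2 * n)) (ZMod 2))
    (D : V → (Fin (n - k) → ZMod 2) → PauliVec n) : ℝ :=
  p.probOf fun u v => D v (syndrome k C u) ≠ u

/-- The rates `k / n` (with `n = m + k`) at which some symplectic `C` and some decoder `D` guess
the error incorrectly with probability at most `ε`. -/
def guessableRates (p : PauliNoise n V) (ε : ℝ) : Set ℝ :=
  {r | ∃ k : ℕ, k ≤ n ∧ r = (k : ℝ) / n ∧
    ∃ C ∈ symplecticMatrices n, ∃ D : V → (Fin (n - k) → ZMod 2) → PauliVec n,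
      p.wrongGuessProb k C D ≤ ε}

/-- The optimal rate for guessing the error from the syndrome. The set of rates is finite, so
this is its maximum as soon as it is nonempty. -/
noncomputable def errorGuessRate (p : PauliNoise n V) (ε : ℝ) : ℝ :=
  sSup (p.guessableRates ε)

/-! ### Sorting the errors by likelihood, and the general bounds -/

/-- `ord v 0, ord v 1, …` lists, for every `v`, all the vectors `u` in order of decreasing
probability of `U = u, V = v`, ties being resolved in any way. -/
def IsSorting (p : PauliNoise n V) (ord : V → Fin (2 ^ (2 * n)) ≃ PauliVec n) : Prop :=
  ∀ v, Antitone fun j => p.mass (ord v j) v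

theorem exists_isSorting (p : PauliNoise n V) : ∃ ord, p.IsSorting ord := by
  have hc : Fintype.card (PauliVec n) = 2 ^ (2 * n) := by simp [PauliVec, ZMod.card]
  let e : PauliVec n ≃ Fin (2 ^ (2 * n)) := Fintype.equivFinOfCardEq hc
  refine ⟨fun v => (Tuple.sort fun j => - p.mass (e.symm j) v).trans e.symm, fun v i j hij => ?_⟩
  have h := Tuple.monotone_sort (fun j => - p.mass (e.symm j) v) hij
  simpa using h

/-- The position `J ∈ {1, …, 2^{2n}}` of `u` in the list for `v`. -/
def position (ord : V → Fin (2 ^ (2 * n)) ≃ PauliVec n) (u : PauliVec n) (v : V) : ℕ :=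
  ((ord v).symm u : ℕ) + 1

/-- The converse bound `P[J > 2^m]` at rate `k / n`, where `m = n - k`. -/
noncomputable def converseBound (p : PauliNoise n V)
    (ord : V → Fin (2 ^ (2 * n)) ≃ PauliVec n) (k : ℕ) : ℝ :=
  p.probOf fun u v => 2 ^ (n - k) < position ord u v

/-- The achievability bound `P[J > 2^m] + E[1{J ≤ 2^m} (J - 1) 2^{-m}]` at rate `k / n`, where
`m = n - k`. -/
noncomputable def achievabilityBound (p : PauliNoise n V)
    (ord : V → Fin (2 ^ (2 * n)) ≃ PauliVec n) (k : ℕ) : ℝ :=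
  p.probOf (fun u v => 2 ^ (n - k) < position ord u v) +
    p.expect fun u v =>
      if position ord u v ≤ 2 ^ (n - k) then ((position ord u v : ℝ) - 1) / 2 ^ (n - k) else 0

end PauliNoise

/-! ### The erasure channels -/

/-- The probability, for a single qubit erasure channel with parameter `δ`, that the flag is `v`
(`1` for erased) and that the Pauli error `X^x Z^z` is applied. -/
noncomputable def erasureWeight (δ : ℝ) (x z v : ZMod 2) : ℝ :=
  if v = 0 then (if x = 0 ∧ z = 0 then 1 - δ else 0) else δ / 4

/-- A sum over all Pauli errors of a product over the qubits factorizes. -/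
theorem sum_prod_pauliVec {R : Type*} [CommSemiring R] (n : ℕ)
    (f : Fin n → ZMod 2 → ZMod 2 → R) :
    ∑ u : PauliVec n, ∏ i, f i (u.xPart i) (u.zPart i) = ∏ i, ∑ x, ∑ z, f i x z := by
  let g : PauliVec n → (Fin n → ZMod 2 × ZMod 2) := fun u i => (u.xPart i, u.zPart i)
  have hg : Function.Injective g := by
    intro u w h
    funext j
    by_cases hj : (j : ℕ) < n
    · have := congrArg Prod.fst (congrFun h ⟨j, hj⟩)
      exact this
    · have hj2 := j.isLt
      have h2 := congrArg Prod.snd (congrFun h ⟨2 * n - 1 - j, by omega⟩)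
      have he : Fin.rev (Fin.castLE (by omega) (⟨2 * n - 1 - j, by omega⟩ : Fin n)) = j := by
        apply Fin.ext
        simp only [Fin.val_rev, Fin.castLE_mk]
        omega
      simp only [g, PauliVec.zPart] at h2
      rwa [he] at h2
  have hb : Function.Bijective g := by
    rw [Fintype.bijective_iff_injective_and_card]
    refine ⟨hg, ?_⟩
    simp [PauliVec, ZMod.card, pow_mul]
  calc ∑ u : PauliVec n, ∏ i, f i (u.xPart i) (u.zPart i)
      = ∑ w : Fin n → ZMod 2 × ZMod 2, ∏ i, f i (w i).1 (w i).2 :=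
        Fintype.sum_bijective g hb _ _ fun _ => rfl
    _ = ∏ i, ∑ y : ZMod 2 × ZMod 2, f i y.1 y.2 :=
        (Fintype.prod_sum fun i (y : ZMod 2 × ZMod 2) => f i y.1 y.2).symm
    _ = ∏ i, ∑ x, ∑ z, f i x z := by simp only [Fintype.sum_prod_type]

/-- The distribution `p_{UV}` for `n` independent qubit erasure channels with parameter `δ`; the
side information is the vector of the `n` erasure flags. -/
noncomputable def erasureNoise (n : ℕ) (δ : ℝ) (hδ : δ ∈ Set.Icc (0 : ℝ) 1) :
    PauliNoise n (Fin n → ZMod 2) where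
  mass u v := ∏ i, erasureWeight δ (u.xPart i) (u.zPart i) (v i)
  mass_nonneg u v := by
    obtain ⟨h0, h1⟩ := hδ
    refine Finset.prod_nonneg fun i _ => ?_
    unfold erasureWeight
    split_ifs <;> linarith
  sum_mass := by
    rw [Finset.sum_comm]
    simp_rw [fun v : Fin n → ZMod 2 =>
      sum_prod_pauliVec n fun i x z => erasureWeight δ x z (v i)]
    rw [← Fintype.prod_sum fun (_ : Fin n) (b : ZMod 2) => ∑ x, ∑ z, erasureWeight δ x z b]
    refine Finset.prod_eq_one fun i _ => ?_
    have h2 : ∀ f : ZMod 2 → ℝ, ∑ x, f x = f 0 + f 1 := fun f => Fin.sum_univ_two f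
    simp only [h2, erasureWeight]
    norm_num
    ring

/-! The quantum channels. The theorem `pauliChannel_erasureNoise` confirms that `erasureNoise` is
the distribution that specifies, as a Pauli channel, the tensor product of `n` erasure channels. -/

/-- The tensor product of matrices on the single qubits. -/
def qubitTensor {n : ℕ} (A : Fin n → Matrix (Fin 2) (Fin 2) ℂ) :
    Matrix (Fin n → Fin 2) (Fin n → Fin 2) ℂ :=
  Matrix.of fun a b => ∏ i, A i (a i) (b i)

/-- The single qubit operator `X^x Z^z`. -/
def qubitPauli (x z : ZMod 2) : Matrix (Fin 2) (Fin 2) ℂ :=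
  !![0, 1; 1, 0] ^ x.val * !![1, 0; 0, -1] ^ z.val

/-- The `n`-qubit Pauli operator `X₁^{u₁} ⋯ Xₙ^{uₙ} Zₙ^{uₙ₊₁} ⋯ Z₁^{u₂ₙ}`. -/
def pauliOperator {n : ℕ} (u : PauliVec n) : Matrix (Fin n → Fin 2) (Fin n → Fin 2) ℂ :=
  qubitTensor fun i => qubitPauli (u.xPart i) (u.zPart i)

/-- The Pauli channel `ρ ↦ ∑ p(u, v) Q^u ρ (Q^u)† ⊗ |v⟩⟨v|`. -/
noncomputable def pauliChannel {n : ℕ} {V : Type*} [Fintype V] [DecidableEq V]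
    (p : PauliNoise n V) (ρ : Matrix (Fin n → Fin 2) (Fin n → Fin 2) ℂ) :
    Matrix ((Fin n → Fin 2) × V) ((Fin n → Fin 2) × V) ℂ :=
  ∑ u, ∑ v, (p.mass u v : ℂ) •
    ((pauliOperator u * ρ * (pauliOperator u).conjTranspose) ⊗ₖ Matrix.single v v 1)

/-- The qubit erasure channel
`ρ ↦ (1 - δ) ρ ⊗ |0⟩⟨0| + (δ / 4) (ρ + X ρ X + Z ρ Z + X Z ρ Z X) ⊗ |1⟩⟨1|`. -/
noncomputable def erasureChannel (δ : ℝ) (ρ : Matrix (Fin 2) (Fin 2) ℂ) :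
    Matrix (Fin 2 × ZMod 2) (Fin 2 × ZMod 2) ℂ :=
  let X : Matrix (Fin 2) (Fin 2) ℂ := !![0, 1; 1, 0]
  let Z : Matrix (Fin 2) (Fin 2) ℂ := !![1, 0; 0, -1]
  ((1 - δ : ℝ) : ℂ) • (ρ ⊗ₖ Matrix.single 0 0 1) +
    ((δ / 4 : ℝ) : ℂ) •
      ((ρ + X * ρ * X + Z * ρ * Z + X * Z * ρ * Z * X) ⊗ₖ Matrix.single 1 1 1)

theorem qubitTensor_mul {n : ℕ} (A B : Fin n → Matrix (Fin 2) (Fin 2) ℂ) :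
    qubitTensor A * qubitTensor B = qubitTensor fun i => A i * B i := by
  ext a b
  simp only [qubitTensor, Matrix.mul_apply, Matrix.of_apply, ← Finset.prod_mul_distrib]
  exact (Fintype.prod_sum fun i (c : Fin 2) => A i (a i) c * B i c (b i)).symm

theorem qubitTensor_conjTranspose {n : ℕ} (A : Fin n → Matrix (Fin 2) (Fin 2) ℂ) :
    (qubitTensor A).conjTranspose = qubitTensor fun i => (A i).conjTranspose := by
  ext a b
  simp [qubitTensor, Matrix.conjTranspose_apply]

theorem erasureChannel_apply (δ : ℝ) (ρ : Matrix (Fin 2) (Fin 2) ℂ) (a b : Fin 2)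
    (v w : ZMod 2) :
    erasureChannel δ ρ (a, v) (b, w) = ∑ x, ∑ z, ((erasureWeight δ x z v : ℝ) : ℂ) *
      ((qubitPauli x z * ρ * (qubitPauli x z).conjTranspose) a b * if v = w then 1 else 0) := by
  have h2 : ∀ f : ZMod 2 → ℂ, ∑ x, f x = f 0 + f 1 := fun f => Fin.sum_univ_two f
  have h01 : ∀ y : ZMod 2, y = 0 ∨ y = 1 := by decide
  have hv0 : (0 : ZMod 2).val = 0 := rfl
  have hv1 : (1 : ZMod 2).val = 1 := rfl
  rw [Matrix.eta_fin_two ρ]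
  rcases h01 v with rfl | rfl <;> rcases h01 w with rfl | rfl <;> fin_cases a <;> fin_cases b <;>
    simp [h2, erasureChannel, erasureWeight, qubitPauli, hv0, hv1,
      Matrix.mul_apply, Fin.sum_univ_two] <;> ring

/-- On product inputs the Pauli channel of `erasureNoise` is the product of erasure channels. -/
theorem pauliChannel_erasureNoise {n : ℕ} (δ : ℝ) (hδ : δ ∈ Set.Icc (0 : ℝ) 1)
    (ρ : Fin n → Matrix (Fin 2) (Fin 2) ℂ) (a b : Fin n → Fin 2) (v w : Fin n → ZMod 2) :
    pauliChannel (erasureNoise n δ hδ) (qubitTensor ρ) (a, v) (b, w) =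
      ∏ i, erasureChannel δ (ρ i) (a i, v i) (b i, w i) := by
  simp_rw [erasureChannel_apply]
  rw [← sum_prod_pauliVec n fun i x z => ((erasureWeight δ x z (v i) : ℝ) : ℂ) *
    ((qubitPauli x z * ρ i * (qubitPauli x z).conjTranspose) (a i) (b i) *
      if v i = w i then 1 else 0)]
  simp only [pauliChannel, Matrix.sum_apply, Matrix.smul_apply, Matrix.kroneckerMap_apply,
    pauliOperator, qubitTensor_conjTranspose, qubitTensor_mul, Matrix.single_apply, smul_eq_mul]
  refine Finset.sum_congr rfl fun u _ => ?_
  rw [Finset.sum_eq_single v]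
  · simp only [erasureNoise, qubitTensor, Matrix.of_apply, Finset.prod_mul_distrib,
      Complex.ofReal_prod, true_and]
    congr 2
    by_cases h : v = w
    · subst h; simp
    · obtain ⟨i, hi⟩ := Function.ne_iff.mp h
      rw [if_neg h, eq_comm]
      exact Finset.prod_eq_zero (Finset.mem_univ i) (if_neg hi)
  · intro c _ hc
    simp [hc]
  · simp

/-! ### Distribution functions -/

/-- The probability that a `Binomial(N, q)` random variable is at most `i`; for `i = -1` the sum
is empty. -/
noncomputable def binomialCDF (N : ℕ) (q : ℝ) (i : ℤ) : ℝ :=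
  ∑ j ∈ Finset.range (i + 1).toNat, (N.choose j : ℝ) * q ^ j * (1 - q) ^ (N - j)

/-- The cumulative distribution function of the standard normal distribution. -/
noncomputable def normalCDF (x : ℝ) : ℝ :=
  1 / √(2 * Real.pi) * ∫ t in Set.Iic x, Real.exp (-t ^ 2 / 2)

/-- The inverse of `normalCDF`, meaningful on `(0, 1)`. -/
noncomputable def normalCDFInv : ℝ → ℝ :=
  Function.invFun normalCDF

/-!
Given the erasure flags, with `E` erased qubits, the error is uniform on a set of `4 ^ E` vectors.
Hence the converse and achievability bounds are the means, over a binomial `E`, of explicit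
functions of `E`, and summing the binomial weights gives the closed forms.

The first `m` coordinates of `C u`, for a symplectic matrix `C`, take at most `2 ^ m` values, so a
guess from the flags and the syndrome succeeds on at most `2 ^ m` errors per flag vector; this gives
the converse. For the other direction, a fixed nonzero error difference is sent to a vector with
vanishing syndrome by a fraction at most `2 ^ (-m)` of all symplectic matrices, since the symplectic
group acts transitively on nonzero vectors, and the union bound over the more likely errors yields a
matrix that attains the achievability bound.

As functions of `E`, both bounds differ from the indicator of `E > m / 2` by at most a multiple of
`4 ^ (-|E - m / 2|)`. By the Berry–Esseen theorem, proved here by Stein's method, both therefore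
equal a normal tail up to `O(1 / √n)`, and inverting the normal distribution function moves this
error into an `O(1 / n)` term of the rate. At `δ = 1 / 2` the predicted number of guessable
qubits may be negative; there `k = 0` is attainable by the symmetry of `E` around `n / 2`.
-/

/-! ### Expectations with respect to a binomial distribution -/

section BinomialMean

/-- The expectation of `g X` for a `Binomial(n, p)` random variable `X`. It is linear in `g`, and
all identities hold formally, for `p` in any commutative ring. -/
def binomialMean {R : Type*} [CommRing R] (n : ℕ) (p : R) (g : ℕ → R) : R :=
  ∑ j ∈ Finset.range (n + 1), (n.choose j : R) * p ^ j * (1 - p) ^ (n - j) * g j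

section CommRing

variable {R : Type*} [CommRing R]

theorem binomialMean_add (n : ℕ) (p : R) (g h : ℕ → R) :
    binomialMean n p (fun j => g j + h j) = binomialMean n p g + binomialMean n p h := by
  simp only [binomialMean, mul_add, Finset.sum_add_distrib]

theorem binomialMean_const_mul (n : ℕ) (p c : R) (g : ℕ → R) :
    binomialMean n p (fun j => c * g j) = c * binomialMean n p g := by
  simp only [binomialMean, Finset.mul_sum, mul_left_comm]

theorem binomialMean_sub (n : ℕ) (p : R) (g h : ℕ → R) :
    binomialMean n p (fun j => g j - h j) = binomialMean n p g - binomialMean n p h := by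
  simp only [binomialMean, mul_sub, Finset.sum_sub_distrib]

theorem binomialMean_const (n : ℕ) (p c : R) : binomialMean n p (fun _ => c) = c := by
  have total := add_pow p (1 - p) n
  simp only [add_sub_cancel, one_pow] at total
  calc binomialMean n p (fun _ => c)
      = (∑ j ∈ Finset.range (n + 1), p ^ j * (1 - p) ^ (n - j) * n.choose j) * c := by
        rw [binomialMean, Finset.sum_mul]
        exact Finset.sum_congr rfl fun j _ => by ring
    _ = c := by rw [← total, one_mul]

theorem binomialMean_congr {n : ℕ} {p : R} {g h : ℕ → R} (H : ∀ j ≤ n, g j = h j) :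
    binomialMean n p g = binomialMean n p h :=
  Finset.sum_congr rfl fun j hj => by rw [H j (Finset.mem_range_succ_iff.mp hj)]

theorem binomialMean_zero_right (n : ℕ) (g : ℕ → R) : binomialMean n 0 g = g 0 := by
  simp [binomialMean, Finset.sum_range_succ']

theorem binomialMean_succ (n : ℕ) (p : R) (g : ℕ → R) :
    binomialMean (n + 1) p g = (1 - p) * binomialMean n p g +
      p * binomialMean n p fun j => g (j + 1) := by
  have no_success : (1 - p) * binomialMean n p g = ∑ j ∈ Finset.range (n + 2),
      (n.choose j : R) * p ^ j * (1 - p) ^ (n + 1 - j) * g j := by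
    rw [Finset.sum_range_succ _ (n + 1), Nat.choose_succ_self, binomialMean, Finset.mul_sum]
    simp only [Nat.cast_zero, zero_mul, add_zero]
    refine Finset.sum_congr rfl fun j hj => ?_
    rw [Nat.succ_sub (Finset.mem_range_succ_iff.mp hj), pow_succ]
    ring
  rw [no_success, binomialMean, Finset.sum_range_succ', Finset.sum_range_succ' _ (n + 1),
    binomialMean, Finset.mul_sum]
  simp only [Nat.choose_succ_succ, Nat.cast_add, add_mul, Finset.sum_add_distrib,
    Nat.add_sub_add_right, Nat.choose_zero_right, pow_succ]
  have shift : ∀ j, (n.choose j : R) * (p ^ j * p) * (1 - p) ^ (n - j) * g (j + 1) =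
      p * ((n.choose j : R) * p ^ j * (1 - p) ^ (n - j) * g (j + 1)) := fun j => by ring
  simp only [shift]
  ring

theorem binomialMean_index_mul (n : ℕ) (p : R) (g : ℕ → R) :
    binomialMean (n + 1) p (fun j => j * g j) =
      (n + 1) * p * binomialMean n p fun j => g (j + 1) := by
  rw [binomialMean, Finset.sum_range_succ', binomialMean, Finset.mul_sum]
  simp only [Nat.cast_zero, zero_mul, mul_zero, add_zero, Nat.add_sub_add_right]
  refine Finset.sum_congr rfl fun j _ => ?_
  have absorb : ((n : R) + 1) * n.choose j = (n + 1).choose (j + 1) * ((j + 1 : ℕ) : R) := by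
    exact_mod_cast congrArg (Nat.cast (R := R)) (Nat.add_one_mul_choose_eq n j)
  linear_combination (-p ^ (j + 1) * (1 - p) ^ (n - j) * g (j + 1)) * absorb

theorem binomialMean_stein (n : ℕ) (p : R) (g : ℕ → R) :
    binomialMean (n + 1) p (fun j => (j - (n + 1) * p) * g j) =
      (n + 1) * p * (1 - p) * binomialMean n p fun j => g (j + 1) - g j := by
  simp only [sub_mul]
  rw [binomialMean_sub, binomialMean_index_mul, binomialMean_const_mul, binomialMean_succ,
    binomialMean_sub]
  ring

theorem binomialMean_variance (n : ℕ) (p : R) :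
    binomialMean n p (fun j => (j - n * p) ^ 2) = n * p * (1 - p) := by
  cases n with
  | zero => simp [binomialMean]
  | succ n =>
    have stein := binomialMean_stein n p fun j => (j : R) - (n + 1) * p
    simp only [Nat.cast_succ, sub_sub_sub_cancel_right, add_sub_cancel_left,
      binomialMean_const, ← sq, mul_one] at stein ⊢
    exact stein

theorem binomialMean_reflect (n : ℕ) (p : R) (g : ℕ → R) :
    binomialMean n (1 - p) (fun j => g (n - j)) = binomialMean n p g := by
  rw [binomialMean, ← Finset.sum_range_reflect]
  refine Finset.sum_congr rfl fun j hj => ?_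
  have hjn := Finset.mem_range_succ_iff.mp hj
  rw [show n + 1 - 1 - j = n - j by omega, Nat.choose_symm hjn, Nat.sub_sub_self hjn,
    sub_sub_cancel]
  ring

end CommRing

theorem binomialMean_pow_mul {K : Type*} [Field K] (n : ℕ) {p x : K} (h : 1 - p + p * x ≠ 0)
    (g : ℕ → K) :
    binomialMean n p (fun j => x ^ j * g j) =
      (1 - p + p * x) ^ n * binomialMean n (p * x / (1 - p + p * x)) g := by
  have complement : 1 - p * x / (1 - p + p * x) = (1 - p) / (1 - p + p * x) := by
    field_simp
    ring
  rw [binomialMean, binomialMean, complement, Finset.mul_sum]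
  refine Finset.sum_congr rfl fun j hj => ?_
  rw [← Nat.add_sub_cancel' (Finset.mem_range_succ_iff.mp hj), pow_add, Nat.add_sub_cancel_left]
  simp only [div_pow, mul_pow]
  field_simp

section LinearOrder

variable {R : Type*} [CommRing R] [LinearOrder R] [IsStrictOrderedRing R] {n : ℕ} {p : R}

theorem binomialMean_mono (hp : p ∈ Set.Icc 0 1) {g h : ℕ → R} (H : ∀ j ≤ n, g j ≤ h j) :
    binomialMean n p g ≤ binomialMean n p h := by
  have hp0 := hp.1
  have hp1 : 0 ≤ 1 - p := sub_nonneg.2 hp.2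
  refine Finset.sum_le_sum fun j hj => ?_
  have := H j (Finset.mem_range_succ_iff.mp hj)
  gcongr

theorem abs_binomialMean_le (hp : p ∈ Set.Icc 0 1) (g : ℕ → R) :
    |binomialMean n p g| ≤ binomialMean n p fun j => |g j| := by
  have hneg : -binomialMean n p g = binomialMean n p fun j => -g j := by
    simpa using (binomialMean_const_mul n p (-1) g).symm
  refine abs_le'.2 ⟨binomialMean_mono hp fun j _ => le_abs_self (g j), ?_⟩
  rw [hneg]
  exact binomialMean_mono hp fun j _ => neg_le_abs (g j)

theorem sq_binomialMean_le (hp : p ∈ Set.Icc 0 1) (g : ℕ → R) :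
    binomialMean n p g ^ 2 ≤ binomialMean n p fun j => g j ^ 2 := by
  set μ := binomialMean n p g with hμ
  have expand : binomialMean n p (fun j => (g j - μ) ^ 2) =
      binomialMean n p (fun j => g j ^ 2) - μ ^ 2 := by
    have (j : ℕ) : (g j - μ) ^ 2 = g j ^ 2 - 2 * μ * g j + μ ^ 2 := by ring
    simp only [this]
    rw [binomialMean_add, binomialMean_sub, binomialMean_const_mul, binomialMean_const, ← hμ]
    ring
  have nonneg : 0 ≤ binomialMean n p fun j => (g j - μ) ^ 2 :=
    (binomialMean_const n p 0).ge.trans (binomialMean_mono hp fun j _ => sq_nonneg (g j - μ))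
  rwa [expand, sub_nonneg] at nonneg

end LinearOrder

section Real

variable {n : ℕ} {p : ℝ}

theorem binomialMean_abs_deviation_le (hp : p ∈ Set.Icc 0 1) :
    binomialMean n p (fun j => |(j : ℝ) - n * p|) ≤ √(n * p * (1 - p)) := by
  refine Real.le_sqrt_of_sq_le ((sq_binomialMean_le hp _).trans_eq ?_)
  simp only [sq_abs, binomialMean_variance]

theorem binomialMean_point_mul_sqrt_le (hp : p ∈ Set.Icc 0 1) (i : ℕ) :
    binomialMean n p (fun j => if j = i then 1 else 0) * √((n + 1) * p * (1 - p)) ≤ 1 := by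
  have hvar : 0 ≤ ((n : ℝ) + 1) * p * (1 - p) :=
    mul_nonneg (mul_nonneg (by positivity) hp.1) (sub_nonneg.2 hp.2)
  rcases hvar.eq_or_lt with h0 | hpos
  · simp [← h0]
  have increment (j : ℕ) : ((if i < j + 1 then (1 : ℝ) else 0) - if i < j then 1 else 0) =
      if j = i then 1 else 0 := by
    split_ifs <;> first | omega | norm_num
  have stein := binomialMean_stein n p fun j => if i < j then 1 else 0
  simp only [increment] at stein
  have tail_deviation : binomialMean (n + 1) p
      (fun j => ((j : ℝ) - (n + 1) * p) * if i < j then 1 else 0) ≤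
        √((n + 1) * p * (1 - p)) := by
    have deviation := binomialMean_abs_deviation_le (n := n + 1) hp
    push_cast at deviation
    refine (binomialMean_mono hp fun j _ => ?_).trans deviation
    split_ifs
    · rw [mul_one]; exact le_abs_self _
    · rw [mul_zero]; exact abs_nonneg _
  refine le_of_mul_le_mul_right ?_ (Real.sqrt_pos.2 hpos)
  rw [stein] at tail_deviation
  rw [mul_assoc, Real.mul_self_sqrt hvar, one_mul, mul_comm]
  exact tail_deviation

end Real

end BinomialMean

/-! ### The standard normal distribution function -/

section NormalCDF

open MeasureTheory ProbabilityTheory Real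

theorem integrable_exp_neg_sq_half : Integrable fun t : ℝ => exp (-t ^ 2 / 2) := by
  simpa only [neg_mul, neg_div, one_div, inv_mul_eq_div] using
    integrable_exp_neg_mul_sq (b := 1 / 2) (by norm_num)

theorem integrable_mul_exp_neg_sq_half : Integrable fun t : ℝ => t * exp (-t ^ 2 / 2) := by
  simpa only [neg_mul, neg_div, one_div, inv_mul_eq_div] using
    integrable_mul_exp_neg_mul_sq (b := 1 / 2) (by norm_num)

theorem sqrt_two_pi_pos : 0 < √(2 * π) := sqrt_pos.2 (by positivity)

theorem gaussianReal_zero_one_real_apply (s : Set ℝ) :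
    (gaussianReal 0 1).real s = 1 / √(2 * π) * ∫ t in s, exp (-t ^ 2 / 2) := by
  rw [measureReal_def, gaussianReal_apply_eq_integral _ one_ne_zero, ENNReal.toReal_ofReal
    (integral_nonneg fun t => gaussianPDFReal_nonneg _ _ t), ← integral_const_mul]
  simp [gaussianPDFReal]

theorem normalCDF_eq_cdf : normalCDF = cdf (gaussianReal 0 1) := by
  funext x
  rw [cdf_eq_real, gaussianReal_zero_one_real_apply, normalCDF]

theorem one_sub_normalCDF (x : ℝ) :
    1 - normalCDF x = 1 / √(2 * π) * ∫ t in Set.Ioi x, exp (-t ^ 2 / 2) := by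
  rw [normalCDF_eq_cdf, cdf_eq_real, ← probReal_compl_eq_one_sub measurableSet_Iic, Set.compl_Iic,
    gaussianReal_zero_one_real_apply]

theorem normalCDF_neg (x : ℝ) : normalCDF (-x) = 1 - normalCDF x := by
  have reflect := integral_comp_neg_Iic (-x) fun t => exp (-t ^ 2 / 2)
  rw [neg_neg] at reflect
  rw [one_sub_normalCDF, ← reflect, normalCDF]
  simp only [neg_sq]

theorem normalCDF_nonneg (x : ℝ) : 0 ≤ normalCDF x := normalCDF_eq_cdf ▸ cdf_nonneg _ x

theorem normalCDF_le_one (x : ℝ) : normalCDF x ≤ 1 := normalCDF_eq_cdf ▸ cdf_le_one _ x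

theorem hasDerivAt_normalCDF (x : ℝ) :
    HasDerivAt normalCDF (1 / √(2 * π) * exp (-x ^ 2 / 2)) x := by
  have density_continuous : Continuous fun t : ℝ => exp (-t ^ 2 / 2) := by fun_prop
  have split : normalCDF = fun y => 1 / √(2 * π) *
      ((∫ t in Set.Iic 0, exp (-t ^ 2 / 2)) + ∫ t in (0 : ℝ)..y, exp (-t ^ 2 / 2)) := by
    funext y
    rw [← intervalIntegral.integral_Iic_sub_Iic integrable_exp_neg_sq_half.integrableOn
      integrable_exp_neg_sq_half.integrableOn, add_sub_cancel, normalCDF]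
  rw [split]
  exact ((density_continuous.integral_hasStrictDerivAt 0 x).hasDerivAt.const_add _).const_mul _

theorem continuous_normalCDF : Continuous normalCDF :=
  continuous_iff_continuousAt.2 fun x => (hasDerivAt_normalCDF x).continuousAt

theorem monotone_normalCDF : Monotone normalCDF := normalCDF_eq_cdf ▸ monotone_cdf _

theorem normalCDF_normalCDFInv {y : ℝ} (hy : y ∈ Set.Ioo (0 : ℝ) 1) :
    normalCDF (normalCDFInv y) = y := by
  have lim_bot : Tendsto normalCDF atBot (nhds 0) := normalCDF_eq_cdf ▸ tendsto_cdf_atBot _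
  have lim_top : Tendsto normalCDF atTop (nhds 1) := normalCDF_eq_cdf ▸ tendsto_cdf_atTop _
  obtain ⟨a, ha⟩ := (lim_bot.eventually_le_const hy.1).exists
  obtain ⟨b, hb⟩ := (lim_top.eventually_const_le hy.2).exists
  exact Function.invFun_eq
    (mem_range_of_exists_le_of_exists_ge continuous_normalCDF ⟨a, ha⟩ ⟨b, hb⟩)

theorem integral_Ioi_mul_exp_neg_sq_half (x : ℝ) :
    ∫ t in Set.Ioi x, t * exp (-t ^ 2 / 2) = exp (-x ^ 2 / 2) := by
  have antiderivative (t : ℝ) :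
      HasDerivAt (fun t : ℝ => -exp (-t ^ 2 / 2)) (t * exp (-t ^ 2 / 2)) t := by
    refine ((((hasDerivAt_id t).pow 2).neg.div_const 2).exp.neg).congr_deriv ?_
    simp only [Pi.neg_apply, Pi.pow_apply, id_eq, Nat.cast_ofNat, mul_one, Nat.add_one_sub_one,
      pow_one]
    ring
  have vanish : Tendsto (fun t : ℝ => -exp (-t ^ 2 / 2)) atTop (nhds 0) := by
    have : Tendsto (fun t : ℝ => t ^ 2 / 2) atTop atTop :=
      (tendsto_pow_atTop two_ne_zero).atTop_div_const two_pos
    simpa only [Function.comp_def, neg_zero, neg_div] using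
      (tendsto_exp_neg_atTop_nhds_zero.comp this).neg
  rw [integral_Ioi_of_hasDerivAt_of_tendsto (antiderivative x).continuousAt.continuousWithinAt
    (fun t _ => antiderivative t) integrable_mul_exp_neg_sq_half.integrableOn vanish]
  ring

theorem mul_one_sub_normalCDF_le (x : ℝ) :
    x * (1 - normalCDF x) ≤ 1 / √(2 * π) * exp (-x ^ 2 / 2) := by
  have tail : ∫ t in Set.Ioi x, x * exp (-t ^ 2 / 2) ≤ ∫ t in Set.Ioi x, t * exp (-t ^ 2 / 2) :=
    setIntegral_mono_on (integrable_exp_neg_sq_half.const_mul x).integrableOn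
      integrable_mul_exp_neg_sq_half.integrableOn measurableSet_Ioi
      fun t ht => mul_le_mul_of_nonneg_right ht.le (exp_pos _).le
  rw [integral_const_mul, integral_Ioi_mul_exp_neg_sq_half] at tail
  rw [one_sub_normalCDF, mul_left_comm]
  exact mul_le_mul_of_nonneg_left tail (by positivity)

/-- The Mills ratio of the standard normal distribution: the upper tail probability divided by the
density. -/
noncomputable def millsRatio (x : ℝ) : ℝ :=
  √(2 * π) * exp (x ^ 2 / 2) * (1 - normalCDF x)

theorem sqrt_two_pi_mul_exp_mul_density (x : ℝ) :
    √(2 * π) * exp (x ^ 2 / 2) * (1 / √(2 * π) * exp (-x ^ 2 / 2)) = 1 := by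
  rw [mul_mul_mul_comm, mul_one_div_cancel sqrt_two_pi_pos.ne', ← exp_add, neg_div, add_neg_cancel,
    exp_zero, mul_one]

theorem millsRatio_nonneg (x : ℝ) : 0 ≤ millsRatio x :=
  mul_nonneg (by positivity) (sub_nonneg.2 (normalCDF_le_one x))

theorem mul_millsRatio_le_one (x : ℝ) : x * millsRatio x ≤ 1 := by
  rw [millsRatio, mul_left_comm]
  exact (mul_le_mul_of_nonneg_left (mul_one_sub_normalCDF_le x) (by positivity)).trans_eq
    (sqrt_two_pi_mul_exp_mul_density x)

theorem hasDerivAt_millsRatio (x : ℝ) : HasDerivAt millsRatio (x * millsRatio x - 1) x := by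
  have exp_deriv : HasDerivAt (fun x : ℝ => √(2 * π) * exp (x ^ 2 / 2))
      (√(2 * π) * (exp (x ^ 2 / 2) * x)) x := by
    refine ((((hasDerivAt_id x).pow 2).div_const 2).exp.const_mul _).congr_deriv ?_
    simp
  refine (exp_deriv.mul ((hasDerivAt_normalCDF x).const_sub 1)).congr_deriv ?_
  rw [millsRatio]
  linear_combination -sqrt_two_pi_mul_exp_mul_density x

theorem antitone_millsRatio : Antitone millsRatio :=
  antitone_of_hasDerivAt_nonpos hasDerivAt_millsRatio
    fun x => sub_nonpos.2 (mul_millsRatio_le_one x)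

theorem millsRatio_le_three_halves {x : ℝ} (hx : 0 ≤ x) : millsRatio x ≤ 3 / 2 := by
  have median : normalCDF 0 = 1 / 2 := by
    have := normalCDF_neg 0
    rw [neg_zero] at this
    linarith
  have sqrt_le : √(2 * π) ≤ 3 := sqrt_le_iff.2 ⟨by norm_num, by linarith [pi_lt_four]⟩
  refine (antitone_millsRatio hx).trans ?_
  simp only [millsRatio, median, zero_pow two_ne_zero, zero_div, exp_zero]
  linarith

theorem normalCDF_mul_millsRatio (x : ℝ) :
    normalCDF x * millsRatio x = (1 - normalCDF x) * millsRatio (-x) := by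
  rw [millsRatio, millsRatio, normalCDF_neg, neg_sq]
  ring

end NormalCDF

/-! ### The Berry–Esseen bound for binomial distributions -/

section SteinMethod

/-- The bounded solution of Stein's equation `f' w - w f w = 1{w ≤ z} - Φ z`. -/
noncomputable def steinSolution (z w : ℝ) : ℝ :=
  if w ≤ z then (1 - normalCDF z) * millsRatio (-w) else normalCDF z * millsRatio w

theorem steinSolution_of_le {z w : ℝ} (h : w ≤ z) :
    steinSolution z w = (1 - normalCDF z) * millsRatio (-w) := if_pos h

theorem steinSolution_of_ge {z w : ℝ} (h : z ≤ w) :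
    steinSolution z w = normalCDF z * millsRatio w := by
  rcases h.eq_or_lt with rfl | h
  · rw [steinSolution_of_le le_rfl, normalCDF_mul_millsRatio]
  · exact if_neg h.not_ge

theorem steinSolution_nonneg (z w : ℝ) : 0 ≤ steinSolution z w := by
  have := sub_nonneg.2 (normalCDF_le_one z)
  have := normalCDF_nonneg z
  have := millsRatio_nonneg w
  have := millsRatio_nonneg (-w)
  unfold steinSolution
  split_ifs <;> positivity

theorem steinSolution_le_millsRatio_abs (z w : ℝ) : steinSolution z w ≤ millsRatio |w| := by
  have weaken {c x : ℝ} (hc : c ≤ 1) : c * millsRatio x ≤ millsRatio x :=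
    mul_le_of_le_one_left (millsRatio_nonneg x) hc
  rcases le_total z w with hz | hz <;> rcases le_total 0 w with h0 | h0
  · rw [steinSolution_of_ge hz, abs_of_nonneg h0]
    exact weaken (normalCDF_le_one z)
  · rw [steinSolution_of_ge hz, abs_of_nonpos h0]
    calc normalCDF z * millsRatio w
        ≤ normalCDF w * millsRatio w :=
          mul_le_mul_of_nonneg_right (monotone_normalCDF hz) (millsRatio_nonneg w)
      _ = (1 - normalCDF w) * millsRatio (-w) := normalCDF_mul_millsRatio w
      _ ≤ millsRatio (-w) := weaken (sub_le_self _ (normalCDF_nonneg w))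
  · rw [steinSolution_of_le hz, abs_of_nonneg h0]
    calc (1 - normalCDF z) * millsRatio (-w)
        ≤ (1 - normalCDF w) * millsRatio (-w) :=
          mul_le_mul_of_nonneg_right (sub_le_sub_left (monotone_normalCDF hz) 1)
            (millsRatio_nonneg (-w))
      _ = normalCDF w * millsRatio w := (normalCDF_mul_millsRatio w).symm
      _ ≤ millsRatio w := weaken (normalCDF_le_one w)
  · rw [steinSolution_of_le hz, abs_of_nonpos h0]
    exact weaken (sub_le_self _ (normalCDF_nonneg z))

theorem steinSolution_le_three_halves (z w : ℝ) : steinSolution z w ≤ 3 / 2 :=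
  (steinSolution_le_millsRatio_abs z w).trans (millsRatio_le_three_halves (abs_nonneg w))

theorem abs_mul_steinSolution_le_one (z w : ℝ) : |w * steinSolution z w| ≤ 1 := by
  rw [abs_mul, abs_of_nonneg (steinSolution_nonneg z w)]
  exact (mul_le_mul_of_nonneg_left (steinSolution_le_millsRatio_abs z w) (abs_nonneg w)).trans
    (mul_millsRatio_le_one |w|)

/-- The derivative of `steinSolution z` prescribed by Stein's equation; at the kink `w = z` it is
the left derivative. -/
noncomputable def steinDeriv (z w : ℝ) : ℝ :=
  w * steinSolution z w + ((if w ≤ z then 1 else 0) - normalCDF z)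

theorem abs_steinDeriv_le_two (z w : ℝ) : |steinDeriv z w| ≤ 2 := by
  have indicator : |(if w ≤ z then 1 else 0) - normalCDF z| ≤ 1 := by
    have := normalCDF_nonneg z
    have := normalCDF_le_one z
    rw [abs_le]
    split_ifs <;> constructor <;> linarith
  exact (abs_add_le _ _).trans (by linarith [abs_mul_steinSolution_le_one z w])

theorem hasDerivAt_steinSolution {z w : ℝ} (h : w ≠ z) :
    HasDerivAt (steinSolution z) (steinDeriv z w) w := by
  rcases lt_or_gt_of_ne h with h | h
  · have left := ((hasDerivAt_millsRatio (-w)).scomp w (hasDerivAt_neg w)).const_mul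
      (1 - normalCDF z)
    refine (left.congr_deriv ?_).congr_of_eventuallyEq
      ((eventually_lt_nhds h).mono fun y hy => steinSolution_of_le hy.le)
    rw [steinDeriv, if_pos h.le, steinSolution_of_le h.le, smul_eq_mul]
    ring
  · have right := (hasDerivAt_millsRatio w).const_mul (normalCDF z)
    refine (right.congr_deriv ?_).congr_of_eventuallyEq
      ((eventually_gt_nhds h).mono fun y hy => steinSolution_of_ge hy.le)
    rw [steinDeriv, if_neg h.not_ge, steinSolution_of_ge h.le]
    ring

theorem continuous_steinSolution (z : ℝ) : Continuous (steinSolution z) := by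
  have cont : Continuous millsRatio :=
    continuous_iff_continuousAt.2 fun x => (hasDerivAt_millsRatio x).continuousAt
  refine Continuous.if_le (by fun_prop) (by fun_prop) continuous_id continuous_const ?_
  rintro w rfl
  exact (normalCDF_mul_millsRatio w).symm

theorem exists_steinDeriv_eq_slope {z a b : ℝ} (hab : a < b) (hz : z ∉ Set.Ioo a b) :
    ∃ x ∈ Set.Ioo a b, steinDeriv z x = (steinSolution z b - steinSolution z a) / (b - a) :=
  exists_hasDerivAt_eq_slope (steinSolution z) (steinDeriv z) hab
    (continuous_steinSolution z).continuousOn fun _ hy =>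
      hasDerivAt_steinSolution fun hyz => hz (hyz ▸ hy)

theorem abs_steinSolution_sub_le (z : ℝ) {a b : ℝ} (hab : a ≤ b) :
    |steinSolution z b - steinSolution z a| ≤ 2 * (b - a) := by
  have off_kink {a b : ℝ} (hab : a ≤ b) (hz : z ∉ Set.Ioo a b) :
      |steinSolution z b - steinSolution z a| ≤ 2 * (b - a) := by
    rcases hab.eq_or_lt with rfl | hlt
    · simp
    obtain ⟨x, -, hx⟩ := exists_steinDeriv_eq_slope hlt hz
    have hpos := sub_pos.2 hlt
    rw [← div_le_iff₀ hpos]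
    simpa only [abs_div, abs_of_pos hpos, hx] using abs_steinDeriv_le_two z x
  by_cases hz : z ∈ Set.Ioo a b
  · calc |steinSolution z b - steinSolution z a|
        ≤ |steinSolution z b - steinSolution z z| + |steinSolution z z - steinSolution z a| :=
          abs_sub_le _ _ _
      _ ≤ 2 * (b - z) + 2 * (z - a) := add_le_add
          (off_kink hz.2.le Set.left_notMem_Ioo) (off_kink hz.1.le Set.right_notMem_Ioo)
      _ = 2 * (b - a) := by ring
  · exact off_kink hab hz

theorem abs_steinDeriv_sub_le {z a x : ℝ} (hax : a ≤ x) (h : a ≤ z ↔ x ≤ z) :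
    |steinDeriv z x - steinDeriv z a| ≤ (3 / 2 + 2 * |a|) * (x - a) := by
  have product_rule : steinDeriv z x - steinDeriv z a = (x - a) * steinSolution z x +
      a * (steinSolution z x - steinSolution z a) := by
    simp only [steinDeriv, h]
    ring
  have hxa := sub_nonneg.2 hax
  calc |steinDeriv z x - steinDeriv z a|
      ≤ (x - a) * steinSolution z x + |a| * |steinSolution z x - steinSolution z a| := by
        rw [product_rule]
        refine (abs_add_le _ _).trans_eq ?_
        rw [abs_mul, abs_mul, abs_of_nonneg hxa, abs_of_nonneg (steinSolution_nonneg z x)]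
    _ ≤ (x - a) * (3 / 2) + |a| * (2 * (x - a)) := by
        gcongr
        exacts [steinSolution_le_three_halves z x, abs_steinSolution_sub_le z hax]
    _ = (3 / 2 + 2 * |a|) * (x - a) := by ring

theorem abs_convexCombination_sub_le {p x y c B : ℝ} (hp : p ∈ Set.Icc (0 : ℝ) 1)
    (hx : |x - c| ≤ B) (hy : |y - c| ≤ B) : |(1 - p) * x + p * y - c| ≤ B := by
  have hp1 := sub_nonneg.2 hp.2
  calc |(1 - p) * x + p * y - c| = |(1 - p) * (x - c) + p * (y - c)| := by congr 1; ring
    _ ≤ (1 - p) * |x - c| + p * |y - c| := by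
        simpa only [abs_mul, abs_of_nonneg hp1, abs_of_nonneg hp.1] using
          abs_add_le ((1 - p) * (x - c)) (p * (y - c))
    _ ≤ (1 - p) * B + p * B :=
        add_le_add (mul_le_mul_of_nonneg_left hx hp1) (mul_le_mul_of_nonneg_left hy hp.1)
    _ = B := by ring

theorem abs_average_steinDeriv_sub_slope_le {p z a h : ℝ} (hp : p ∈ Set.Icc (0 : ℝ) 1)
    (hh : 0 < h) :
    |(1 - p) * steinDeriv z a + p * steinDeriv z (a + h) -
        (steinSolution z (a + h) - steinSolution z a) / h| ≤
      2 * (3 / 2 + 2 * |a|) * h + if a ≤ z ∧ z < a + h then 4 else 0 := by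
  have hah : a ≤ a + h := by linarith
  have main_nonneg : 0 ≤ 2 * (3 / 2 + 2 * |a|) * h := by positivity
  have slope_eq : (steinSolution z (a + h) - steinSolution z a) / (a + h - a) =
      (steinSolution z (a + h) - steinSolution z a) / h := by rw [add_sub_cancel_left]
  split_ifs with hz
  · have slope_le : |(steinSolution z (a + h) - steinSolution z a) / h| ≤ 2 := by
      rw [abs_div, abs_of_pos hh, div_le_iff₀ hh]
      simpa using abs_steinSolution_sub_le z hah
    have crude (w : ℝ) :
        |steinDeriv z w - (steinSolution z (a + h) - steinSolution z a) / h| ≤ 4 :=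
      ((abs_sub _ _).trans (add_le_add (abs_steinDeriv_le_two z w) slope_le)).trans_eq
        (by norm_num)
    exact (abs_convexCombination_sub_le hp (crude a) (crude _)).trans (by linarith)
  · have same_side {w : ℝ} (hw : w ∈ Set.Icc a (a + h)) : a ≤ z ↔ w ≤ z :=
      ⟨fun haz => hw.2.trans (not_lt.1 fun h => hz ⟨haz, h⟩), hw.1.trans⟩
    obtain ⟨x, hx, slope⟩ := exists_steinDeriv_eq_slope (show a < a + h by linarith)
      fun hz' => hz ⟨hz'.1.le, hz'.2⟩
    have near {w : ℝ} (hw : w ∈ Set.Icc a (a + h)) :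
        |steinDeriv z w - steinDeriv z a| ≤ (3 / 2 + 2 * |a|) * h :=
      (abs_steinDeriv_sub_le hw.1 (same_side hw)).trans
        (mul_le_mul_of_nonneg_left (by linarith [hw.2]) (by positivity))
    have close {w : ℝ} (hw : w ∈ Set.Icc a (a + h)) :
        |steinDeriv z w - (steinSolution z (a + h) - steinSolution z a) / h| ≤
          2 * (3 / 2 + 2 * |a|) * h := by
      rw [← slope_eq, ← slope]
      refine (abs_sub_le _ (steinDeriv z a) _).trans ?_
      rw [abs_sub_comm (steinDeriv z a)]
      linarith [near hw, near ⟨hx.1.le, hx.2.le⟩]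
    rw [add_zero]
    exact abs_convexCombination_sub_le hp (close ⟨le_rfl, hah⟩) (close ⟨hah, le_rfl⟩)

end SteinMethod

section BerryEsseen

theorem binomialMean_stein_slope {n : ℕ} {p s : ℝ} (hs : 0 < s)
    (hvar : (n + 1) * p * (1 - p) = s ^ 2) (f : ℝ → ℝ) :
    binomialMean (n + 1) p
        (fun j => ((j : ℝ) - (n + 1) * p) / s * f (((j : ℝ) - (n + 1) * p) / s)) =
      binomialMean n p fun j => (f (((j : ℝ) - (n + 1) * p) / s + 1 / s) -
        f (((j : ℝ) - (n + 1) * p) / s)) / (1 / s) := by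
  have stein := binomialMean_stein n p fun j => 1 / s * f (((j : ℝ) - (n + 1) * p) / s)
  rw [hvar, ← binomialMean_const_mul] at stein
  refine Eq.trans (binomialMean_congr fun j _ => by ring) (stein.trans
    (binomialMean_congr fun j _ => ?_))
  push_cast
  field_simp
  ring_nf

theorem binomialMean_abs_score_le {n : ℕ} {p s : ℝ} (hp : p ∈ Set.Icc (0 : ℝ) 1) (hs : 1 ≤ s)
    (hvar : (n + 1) * p * (1 - p) = s ^ 2) :
    binomialMean n p (fun j => |((j : ℝ) - (n + 1) * p) / s|) ≤ 2 := by
  have hs0 : 0 < s := by linarith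
  have recentre (j : ℕ) : |((j : ℝ) - (n + 1) * p) / s| ≤ 1 / s * |(j : ℝ) - n * p| + 1 := by
    rw [abs_div, abs_of_pos hs0, div_le_iff₀ hs0, add_mul (_ * _), mul_right_comm,
      one_div_mul_cancel hs0.ne', one_mul]
    calc |(j : ℝ) - (n + 1) * p| = |((j : ℝ) - n * p) - p| := by congr 1; ring
      _ ≤ |(j : ℝ) - n * p| + |p| := abs_sub _ _
      _ ≤ |(j : ℝ) - n * p| + 1 * s := by rw [abs_of_nonneg hp.1]; linarith [hp.2]
  have deviation : binomialMean n p (fun j => |(j : ℝ) - n * p|) ≤ s := by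
    refine (binomialMean_abs_deviation_le hp).trans (Real.sqrt_le_iff.2 ⟨hs0.le, ?_⟩)
    linarith [mul_nonneg hp.1 (sub_nonneg.2 hp.2)]
  calc binomialMean n p (fun j => |((j : ℝ) - (n + 1) * p) / s|)
      ≤ binomialMean n p fun j => 1 / s * |(j : ℝ) - n * p| + 1 :=
        binomialMean_mono hp fun j _ => recentre j
    _ = 1 / s * binomialMean n p (fun j => |(j : ℝ) - n * p|) + 1 := by
        rw [binomialMean_add, binomialMean_const, binomialMean_const_mul]
    _ ≤ 1 / s * s + 1 := by gcongr
    _ = 2 := by rw [one_div_mul_cancel hs0.ne']; norm_num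

theorem binomialMean_floor_le {n : ℕ} {p s : ℝ} (hp : p ∈ Set.Icc (0 : ℝ) 1) (hs : 0 < s)
    (hvar : (n + 1) * p * (1 - p) = s ^ 2) (x : ℝ) :
    binomialMean n p (fun j => if (j : ℝ) ≤ x ∧ x < j + 1 then 1 else 0) ≤ 1 / s := by
  have point := binomialMean_point_mul_sqrt_le (n := n) hp ⌊x⌋₊
  rw [hvar, Real.sqrt_sq hs.le] at point
  rw [le_div_iff₀ hs]
  refine le_trans (mul_le_mul_of_nonneg_right (binomialMean_mono hp fun j _ => ?_) hs.le) point
  by_cases hj : (j : ℝ) ≤ x ∧ x < j + 1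
  · have := (Nat.floor_eq_iff (j.cast_nonneg.trans hj.1)).2 hj
    rw [if_pos hj, if_pos this.symm]
  · rw [if_neg hj]
    positivity

/-- Stein's method: averaging Stein's equation over the distribution turns the error of the normal
approximation into the mean difference between the derivative and the difference quotients of the
solution, which is of order `1 / s` except on the one step that crosses the kink. -/
theorem abs_binomialMean_score_le_sub_normalCDF_le {n : ℕ} {p s : ℝ}
    (hp : p ∈ Set.Icc (0 : ℝ) 1) (hs : 1 ≤ s) (hvar : (n + 1) * p * (1 - p) = s ^ 2) (z : ℝ) :
    |binomialMean (n + 1) p (fun j => if ((j : ℝ) - (n + 1) * p) / s ≤ z then 1 else 0) -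
      normalCDF z| ≤ 15 / s := by
  have hs0 : 0 < s := by linarith
  set a : ℕ → ℝ := fun j => ((j : ℝ) - (n + 1) * p) / s with ha
  have a_succ (j : ℕ) : a (j + 1) = a j + 1 / s := by simp only [ha]; push_cast; ring
  have error_eq : binomialMean (n + 1) p (fun j => if a j ≤ z then 1 else 0) - normalCDF z =
      binomialMean n p fun j => (1 - p) * steinDeriv z (a j) + p * steinDeriv z (a j + 1 / s) -
        (steinSolution z (a j + 1 / s) - steinSolution z (a j)) / (1 / s) := by
    have pascal := binomialMean_succ n p fun j => steinDeriv z (a j)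
    simp only [a_succ] at pascal
    rw [binomialMean_sub, binomialMean_add, binomialMean_const_mul, binomialMean_const_mul,
      ← pascal, ← binomialMean_stein_slope hs0 hvar]
    simp only [steinDeriv, binomialMean_add, binomialMean_sub, binomialMean_const]
    ring
  have crossing (j : ℕ) : (a j ≤ z ∧ z < a j + 1 / s) ↔
      ((j : ℝ) ≤ (n + 1) * p + z * s ∧ (n + 1) * p + z * s < j + 1) := by
    rw [← a_succ, ha, div_le_iff₀ hs0, lt_div_iff₀ hs0, sub_le_iff_le_add', lt_sub_iff_add_lt']
    push_cast
    rfl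
  calc _ ≤ binomialMean n p fun j => 3 * (1 / s) + 4 * (1 / s) * |a j| +
          4 * if (j : ℝ) ≤ (n + 1) * p + z * s ∧ (n + 1) * p + z * s < j + 1 then 1 else 0 := by
        rw [error_eq]
        refine (abs_binomialMean_le hp _).trans (binomialMean_mono hp fun j _ => ?_)
        refine (abs_average_steinDeriv_sub_slope_le hp (one_div_pos.2 hs0)).trans_eq ?_
        simp only [crossing, mul_ite, mul_one, mul_zero]
        ring
    _ ≤ 3 * (1 / s) + 4 * (1 / s) * 2 + 4 * (1 / s) := by
        rw [binomialMean_add, binomialMean_add, binomialMean_const, binomialMean_const_mul,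
          binomialMean_const_mul]
        gcongr
        exacts [binomialMean_abs_score_le hp hs hvar, binomialMean_floor_le hp hs0 hvar _]
    _ = 15 / s := by ring

theorem abs_binomialMean_le_sub_normalCDF_le {n : ℕ} {p s : ℝ} (hp : p ∈ Set.Icc (0 : ℝ) 1)
    (hs : 0 < s) (hvar : n * p * (1 - p) = s ^ 2) (x : ℝ) :
    |binomialMean n p (fun j => if (j : ℝ) ≤ x then 1 else 0) - normalCDF ((x - n * p) / s)| ≤
      15 / s := by
  rcases le_total 1 s with hs1 | hs1
  · cases n with
    | zero => simp [(pow_pos hs 2).ne] at hvar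
    | succ n =>
      push_cast at hvar ⊢
      simpa only [div_le_div_iff_of_pos_right hs, sub_le_sub_iff_right] using
        abs_binomialMean_score_le_sub_normalCDF_le hp hs1 hvar ((x - (n + 1) * p) / s)
  · have prob_nonneg : 0 ≤ binomialMean n p fun j => if (j : ℝ) ≤ x then 1 else 0 :=
      (binomialMean_const n p 0).ge.trans (binomialMean_mono hp fun j _ => by positivity)
    have prob_le : binomialMean n p (fun j => if (j : ℝ) ≤ x then 1 else 0) ≤ 1 :=
      (binomialMean_mono hp fun j _ => by split_ifs <;> norm_num).trans_eq
        (binomialMean_const n p 1)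
    have trivial_bound : 1 ≤ 15 / s := by
      rw [le_div_iff₀ hs]
      linarith
    refine (abs_sub_le_of_nonneg_of_le prob_nonneg prob_le (normalCDF_nonneg _)
      (normalCDF_le_one _)).trans trivial_bound

theorem sum_range_pow_dist_le {r : ℝ} (h0 : 0 ≤ r) (h1 : r < 1) (M K : ℕ) :
    ∑ j ∈ Finset.range K, r ^ Nat.dist M j ≤ 2 / (1 - r) := by
  have geometric (L : ℕ) : ∑ j ∈ Finset.range L, r ^ j ≤ 1 / (1 - r) := by
    rw [one_div, ← tsum_geometric_of_lt_one h0 h1]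
    exact (summable_geometric_of_lt_one h0 h1).sum_le_tsum _ fun j _ => pow_nonneg h0 j
  have below : ∑ j ∈ Finset.range (M + 1), r ^ Nat.dist M j ≤ 1 / (1 - r) := by
    rw [← Finset.sum_range_reflect]
    refine le_of_eq_of_le (Finset.sum_congr rfl fun j hj => ?_) (geometric (M + 1))
    have := Finset.mem_range_succ_iff.1 hj
    rw [Nat.dist_eq_sub_of_le_right (by omega)]
    congr 1
    omega
  have above : ∑ j ∈ Finset.range K, r ^ Nat.dist M (M + 1 + j) ≤ 1 / (1 - r) := by
    refine (Finset.sum_le_sum fun j _ => ?_).trans (geometric K)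
    rw [Nat.dist_eq_sub_of_le (by omega)]
    exact pow_le_pow_of_le_one h0 h1.le (by omega)
  calc ∑ j ∈ Finset.range K, r ^ Nat.dist M j
      ≤ ∑ j ∈ Finset.range (M + 1 + K), r ^ Nat.dist M j :=
        Finset.sum_le_sum_of_subset_of_nonneg (Finset.range_mono (by omega))
          fun _ _ _ => pow_nonneg h0 _
    _ ≤ 1 / (1 - r) + 1 / (1 - r) := by
        rw [Finset.sum_range_add]
        exact add_le_add below above
    _ = 2 / (1 - r) := by ring

theorem binomialMean_pow_dist_le {n : ℕ} {p s r : ℝ} (hp : p ∈ Set.Icc (0 : ℝ) 1)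
    (hs : 0 < s) (hvar : n * p * (1 - p) = s ^ 2) (h0 : 0 ≤ r) (h1 : r < 1) (M : ℕ) :
    binomialMean n p (fun j => r ^ Nat.dist M j) ≤ 2 / (1 - r) / s := by
  have point (i : ℕ) : binomialMean n p (fun j => if j = i then 1 else 0) ≤ 1 / s := by
    rw [le_div_iff₀ hs]
    have hpq := mul_nonneg hp.1 (sub_nonneg.2 hp.2)
    have s_le : s ≤ √((n + 1) * p * (1 - p)) := Real.le_sqrt_of_sq_le (by linarith)
    have prob_nonneg : 0 ≤ binomialMean n p fun j => if j = i then 1 else 0 :=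
      (binomialMean_const n p 0).ge.trans (binomialMean_mono hp fun j _ => by positivity)
    exact (mul_le_mul_of_nonneg_left s_le prob_nonneg).trans (binomialMean_point_mul_sqrt_le hp i)
  have expand : binomialMean n p (fun j => r ^ Nat.dist M j) =
      ∑ i ∈ Finset.range (n + 1),
        r ^ Nat.dist M i * binomialMean n p fun j => if j = i then 1 else 0 := by
    simp only [binomialMean, mul_ite, mul_one, mul_zero, Finset.sum_ite_eq', Finset.mem_range]
    refine Finset.sum_congr rfl fun i hi => ?_
    rw [if_pos (Finset.mem_range.1 hi), mul_comm]
  calc _ ≤ ∑ i ∈ Finset.range (n + 1), r ^ Nat.dist M i * (1 / s) := by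
        rw [expand]
        exact Finset.sum_le_sum fun i _ => mul_le_mul_of_nonneg_left (point i) (by positivity)
    _ ≤ 2 / (1 - r) * (1 / s) := by
        rw [← Finset.sum_mul]
        exact mul_le_mul_of_nonneg_right (sum_range_pow_dist_le h0 h1 M _) (by positivity)
    _ = 2 / (1 - r) / s := by ring

theorem abs_binomialMean_sub_tail_le {n : ℕ} {p s c r : ℝ} (hp : p ∈ Set.Icc (0 : ℝ) 1)
    (hs : 0 < s) (hvar : n * p * (1 - p) = s ^ 2) (hc : 0 ≤ c) (h0 : 0 ≤ r) (h1 : r < 1) {M : ℕ}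
    {g : ℕ → ℝ} (hg : ∀ j ≤ n, |g j - if M < j then 1 else 0| ≤ c * r ^ Nat.dist M j) :
    |binomialMean n p g - (1 - normalCDF ((M - n * p) / s))| ≤
      c * (2 / (1 - r) / s) + 15 / s := by
  have tail_eq : binomialMean n p (fun j => if M < j then 1 else 0) =
      1 - binomialMean n p fun j => if (j : ℝ) ≤ M then 1 else 0 := by
    rw [← binomialMean_const n p 1, ← binomialMean_sub]
    refine binomialMean_congr fun j _ => ?_
    simp only [Nat.cast_le, binomialMean_const]
    split_ifs <;> first | omega | norm_num
  have smoothing : |binomialMean n p g - binomialMean n p (fun j => if M < j then 1 else 0)| ≤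
      c * (2 / (1 - r) / s) := by
    rw [← binomialMean_sub]
    refine (abs_binomialMean_le hp _).trans ((binomialMean_mono hp hg).trans ?_)
    rw [binomialMean_const_mul]
    exact mul_le_mul_of_nonneg_left (binomialMean_pow_dist_le hp hs hvar h0 h1 M) hc
  refine (abs_sub_le _ _ _).trans (add_le_add smoothing ?_)
  rw [tail_eq, sub_sub_sub_cancel_left, abs_sub_comm]
  exact abs_binomialMean_le_sub_normalCDF_le hp hs hvar M

end BerryEsseen

/-! ### The errors of the erasure channels -/

section Expectation

variable {n : ℕ} {V : Type*} [Fintype V]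

theorem PauliNoise.probOf_eq_expect (p : PauliNoise n V) (E : PauliVec n → V → Prop)
    [∀ u v, Decidable (E u v)] : p.probOf E = p.expect fun u v => if E u v then 1 else 0 := by
  simp only [probOf, expect, mul_ite, mul_one, mul_zero]
  congr!

theorem PauliNoise.achievabilityBound_eq_expect (p : PauliNoise n V)
    (ord : V → Fin (2 ^ (2 * n)) ≃ PauliVec n) (k : ℕ) :
    p.achievabilityBound ord k =
      p.expect fun u v => min 1 (((ord v).symm u : ℕ) / (2 : ℝ) ^ (n - k)) := by
  rw [achievabilityBound, probOf_eq_expect]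
  simp only [expect, ← Finset.sum_add_distrib, ← mul_add]
  refine Finset.sum_congr rfl fun u _ => Finset.sum_congr rfl fun v _ => ?_
  have hpow : (0 : ℝ) < 2 ^ (n - k) := by positivity
  by_cases h : 2 ^ (n - k) < position ord u v
  · have hle : 2 ^ (n - k) ≤ ((ord v).symm u : ℕ) := Nat.le_of_lt_succ h
    rw [if_pos h, if_neg (not_le.2 h), add_zero,
      min_eq_left ((one_le_div hpow).2 (by exact_mod_cast hle))]
  · have hle : ((ord v).symm u : ℕ) ≤ 2 ^ (n - k) := Nat.le_of_succ_le (not_lt.1 h)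
    rw [if_neg h, if_pos (not_lt.1 h), zero_add, position, Nat.cast_add, Nat.cast_one,
      add_sub_cancel_right, min_eq_right ((div_le_one hpow).2 (by exact_mod_cast hle))]

end Expectation

section LowerSet

theorem mem_iff_lt_card_of_isLowerSet {N : ℕ} {S : Finset (Fin N)}
    (hS : IsLowerSet (S : Set (Fin N))) (j : Fin N) : j ∈ S ↔ (j : ℕ) < S.card := by
  refine ⟨fun hj => ?_, fun hj => ?_⟩
  · have hsub : Finset.Iic j ⊆ S := fun i hi => hS (Finset.mem_Iic.1 hi) hj
    have := Finset.card_le_card hsub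
    rw [Fin.card_Iic] at this
    omega
  · by_contra hjS
    have hsub : S ⊆ Finset.Iio j := fun i hi =>
      Finset.mem_Iio.2 (lt_of_not_ge fun hji => hjS (hS hji hi))
    have := Finset.card_le_card hsub
    rw [Fin.card_Iio] at this
    omega

theorem isLowerSet_of_antitone_ite {α : Type*} [Preorder α] {S : Set α} [DecidablePred (· ∈ S)]
    {c : ℝ} (hc : 0 < c) (h : Antitone fun j => if j ∈ S then c else 0) : IsLowerSet S := by
  intro i j hji hi
  by_contra hj
  have := h hji
  simp only [if_pos hi, if_neg hj] at this
  exact this.not_gt hc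

theorem sum_mem_eq_sum_range_card {R : Type*} [AddCommMonoid R] {N : ℕ} {S : Finset (Fin N)}
    (hS : IsLowerSet (S : Set (Fin N))) (h : ℕ → R) :
    ∑ j ∈ S, h j = ∑ j ∈ Finset.range S.card, h j := by
  have hcard : S.card ≤ N := by simpa using S.card_le_univ
  have hmap : S.map Fin.valEmbedding = Finset.range S.card := by
    ext j
    simp only [Finset.mem_map, Fin.valEmbedding_apply, Finset.mem_range]
    constructor
    · rintro ⟨i, hi, rfl⟩
      exact (mem_iff_lt_card_of_isLowerSet hS i).1 hi
    · exact fun hj => ⟨⟨j, hj.trans_le hcard⟩, (mem_iff_lt_card_of_isLowerSet hS _).2 hj, rfl⟩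
  rw [← hmap, Finset.sum_map]
  rfl

end LowerSet

section ErasurePattern

variable {n : ℕ}

/-- The number of erased qubits, `v` being the vector of erasure flags. -/
def erasureCount (v : Fin n → ZMod 2) : ℕ :=
  (Finset.univ.filter fun i => v i ≠ 0).card

/-- The Pauli errors that can occur when `v` is the vector of erasure flags: those that act only
on erased qubits. -/
def IsErasureError (v : Fin n → ZMod 2) (u : PauliVec n) : Prop :=
  ∀ i, v i = 0 → u.xPart i = 0 ∧ u.zPart i = 0

instance (v : Fin n → ZMod 2) : DecidablePred (IsErasureError v) := fun u =>
  inferInstanceAs (Decidable (∀ i, v i = 0 → u.xPart i = 0 ∧ u.zPart i = 0))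

theorem prod_ite_erased {R : Type*} [CommMonoid R] (v : Fin n → ZMod 2) (a b : R) :
    ∏ i, (if v i = 0 then a else b) = a ^ (n - erasureCount v) * b ^ erasureCount v := by
  have hcompl := Finset.card_filter_add_card_filter_not (s := (Finset.univ : Finset (Fin n)))
    (fun i => v i = 0)
  rw [Finset.card_univ, Fintype.card_fin] at hcompl
  rw [Finset.prod_ite, Finset.prod_const, Finset.prod_const, erasureCount]
  congr 2
  exact Nat.eq_sub_of_add_eq hcompl

theorem erasureNoise_mass {δ : ℝ} (hδ : δ ∈ Set.Icc (0 : ℝ) 1) (u : PauliVec n)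
    (v : Fin n → ZMod 2) :
    (erasureNoise n δ hδ).mass u v = if IsErasureError v u then
      (1 - δ) ^ (n - erasureCount v) * (δ / 4) ^ erasureCount v else 0 := by
  change ∏ i, erasureWeight δ (u.xPart i) (u.zPart i) (v i) = _
  split_ifs with h
  · rw [← prod_ite_erased]
    exact Finset.prod_congr rfl fun i _ => ite_congr rfl (fun hi => if_pos (h i hi)) fun _ => rfl
  · obtain ⟨i, hi⟩ := not_forall.1 h
    obtain ⟨hv, hu⟩ := Classical.not_imp.1 hi
    refine Finset.prod_eq_zero (Finset.mem_univ i) ?_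
    rw [erasureWeight, if_pos hv, if_neg hu]

theorem card_isErasureError (v : Fin n → ZMod 2) :
    (Finset.univ.filter (IsErasureError v)).card = 4 ^ erasureCount v := by
  have perQubit (i : Fin n) : ∑ x : ZMod 2, ∑ z : ZMod 2,
      (if v i = 0 → x = 0 ∧ z = 0 then 1 else 0) = if v i = 0 then 1 else 4 := by
    generalize v i = a
    revert a
    decide
  calc (Finset.univ.filter (IsErasureError v)).card
      = ∑ u : PauliVec n, ∏ i, if v i = 0 → u.xPart i = 0 ∧ u.zPart i = 0 then 1 else 0 := by
        simp only [Finset.card_filter, Finset.prod_ite_zero, IsErasureError, Finset.mem_univ,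
          true_imp_iff, Finset.prod_const_one]
        congr!
    _ = ∏ i, if v i = 0 then 1 else 4 := by
        rw [sum_prod_pauliVec n fun i x z => if v i = 0 → x = 0 ∧ z = 0 then 1 else 0]
        exact Finset.prod_congr rfl fun i _ => perQubit i
    _ = 4 ^ erasureCount v := by rw [prod_ite_erased, one_pow, one_mul]

theorem sum_erasureCount {R : Type*} [CommSemiring R] (F : ℕ → R) :
    ∑ v : Fin n → ZMod 2, F (erasureCount v) =
      ∑ e ∈ Finset.range (n + 1), n.choose e * F e := by
  have h := Finset.sum_powerset_apply_card F (x := (Finset.univ : Finset (Fin n)))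
  simp only [Finset.powerset_univ, Finset.card_univ, Fintype.card_fin, nsmul_eq_mul] at h
  rw [← h]
  refine Fintype.sum_bijective (fun v : Fin n → ZMod 2 => Finset.univ.filter fun i => v i ≠ 0)
    ⟨fun v w hvw => ?_, fun s => ⟨fun i => if i ∈ s then 1 else 0, by ext i; simp⟩⟩ _ _ fun v => rfl
  have nonzero_iff_eq : ∀ a b : ZMod 2, (a ≠ 0 ↔ b ≠ 0) → a = b := by decide
  funext i
  exact nonzero_iff_eq _ _ (by simpa using Finset.ext_iff.1 hvw i)

end ErasurePattern

section ErasurePosition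

variable {n : ℕ} {δ : ℝ} (hδ : δ ∈ Set.Icc (0 : ℝ) 1)
  {ord : (Fin n → ZMod 2) → Fin (2 ^ (2 * n)) ≃ PauliVec n}

include hδ in
/-- Given the erasure pattern `v`, all `4 ^ e` possible errors are equally likely, so they are the
first `4 ^ e` entries of the list for `v`. -/
theorem sum_erasureNoise_mass_mul (hord : (erasureNoise n δ hδ).IsSorting ord)
    (v : Fin n → ZMod 2) (h : ℕ → ℝ) :
    ∑ u, (erasureNoise n δ hδ).mass u v * h ((ord v).symm u) =
      (1 - δ) ^ (n - erasureCount v) * (δ / 4) ^ erasureCount v *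
        ∑ j ∈ Finset.range (4 ^ erasureCount v), h j := by
  set c := (1 - δ) ^ (n - erasureCount v) * (δ / 4) ^ erasureCount v with hc
  set S := (Finset.univ.filter (IsErasureError v)).map (ord v).symm.toEmbedding with hS
  have mass_eq (j) : (erasureNoise n δ hδ).mass (ord v j) v = if j ∈ S then c else 0 := by
    simp [erasureNoise_mass, hS, hc]
  have hcard : S.card = 4 ^ erasureCount v := (Finset.card_map _).trans (card_isErasureError v)
  have c_nonneg : 0 ≤ c :=
    mul_nonneg (pow_nonneg (sub_nonneg.2 hδ.2) _) (pow_nonneg (div_nonneg hδ.1 zero_le_four) _)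
  have reindex : ∑ u, (erasureNoise n δ hδ).mass u v * h ((ord v).symm u) =
      c * ∑ j ∈ S, h j := by
    rw [← Equiv.sum_comp (ord v)]
    simp [mass_eq, Finset.mul_sum, Finset.sum_ite_mem]
  rcases c_nonneg.eq_or_lt with h0 | hpos
  · rw [reindex, ← h0, zero_mul, zero_mul]
  · have lower : IsLowerSet (S : Set (Fin (2 ^ (2 * n)))) := by
      refine isLowerSet_of_antitone_ite hpos ?_
      simpa only [Finset.mem_coe, ← mass_eq] using hord v
    rw [reindex, sum_mem_eq_sum_range_card lower, hcard]

theorem erasureNoise_expect_position (hord : (erasureNoise n δ hδ).IsSorting ord) (h : ℕ → ℝ) :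
    (erasureNoise n δ hδ).expect (fun u v => h ((ord v).symm u)) =
      binomialMean n δ fun e => (∑ j ∈ Finset.range (4 ^ e), h j) / 4 ^ e := by
  rw [PauliNoise.expect, Finset.sum_comm]
  simp only [sum_erasureNoise_mass_mul hδ hord]
  rw [sum_erasureCount fun e => (1 - δ) ^ (n - e) * (δ / 4) ^ e *
    ∑ j ∈ Finset.range (4 ^ e), h j, binomialMean]
  refine Finset.sum_congr rfl fun e _ => ?_
  rw [div_pow]
  ring

end ErasurePosition

section ErasureBounds

theorem sum_range_ite_lt_succ {R : Type*} [AddCommMonoidWithOne R] (K M : ℕ) :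
    ∑ j ∈ Finset.range K, (if M < j + 1 then (1 : R) else 0) = ((K - M : ℕ) : R) := by
  have hfilter : (Finset.range K).filter (fun j => M < j + 1) = Finset.Ico M K := by
    ext j
    simp only [Finset.mem_filter, Finset.mem_range, Finset.mem_Ico]
    omega
  rw [Finset.sum_boole, hfilter, Nat.card_Ico]

theorem sum_range_cast_div {F : Type*} [Field F] [CharZero F] (K : ℕ) (M : F) :
    ∑ j ∈ Finset.range K, (j : F) / M = K * (K - 1) / 2 / M := by
  rw [← Finset.sum_div]
  congr 1
  induction K with
  | zero => simp
  | succ K ih =>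
    rw [Finset.sum_range_succ, ih]
    push_cast
    ring

section LinearOrder

variable {F : Type*} [Field F] [LinearOrder F] [IsStrictOrderedRing F] {K M : ℕ}

theorem sum_range_min_one_div_of_le (h : K ≤ M) :
    ∑ j ∈ Finset.range K, min 1 ((j : F) / M) = K * (K - 1) / 2 / M := by
  rw [← sum_range_cast_div]
  refine Finset.sum_congr rfl fun j hj => min_eq_right (div_le_one_of_le₀ ?_ M.cast_nonneg)
  exact_mod_cast (Finset.mem_range.1 hj).le.trans h

theorem sum_range_min_one_div_of_ge (hM : 0 < M) (h : M ≤ K) :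
    ∑ j ∈ Finset.range K, min 1 ((j : F) / M) = K - (M + 1) / 2 := by
  have hM' : (0 : F) < M := Nat.cast_pos.2 hM
  have saturated : ∑ j ∈ Finset.Ico M K, min 1 ((j : F) / M) = K - M := by
    rw [← Nat.cast_sub h, ← Nat.card_Ico, Finset.card_eq_sum_ones, Nat.cast_sum, Nat.cast_one]
    refine Finset.sum_congr rfl fun j hj => min_eq_left ((one_le_div hM').2 ?_)
    exact_mod_cast (Finset.mem_Ico.1 hj).1
  rw [← Finset.sum_range_add_sum_Ico _ h, sum_range_min_one_div_of_le le_rfl, saturated]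
  field_simp
  ring

end LinearOrder

theorem two_pow_le_four_pow {m e : ℕ} (h : m / 2 < e) : 2 ^ m ≤ 4 ^ e := by
  rw [show 4 = 2 ^ 2 from rfl, ← pow_mul]
  exact Nat.pow_le_pow_right two_pos (by omega)

theorem four_pow_le_two_pow {m e : ℕ} (h : ¬m / 2 < e) : 4 ^ e ≤ 2 ^ m := by
  rw [show 4 = 2 ^ 2 from rfl, ← pow_mul]
  exact Nat.pow_le_pow_right two_pos (by omega)

/-- The probability that the position of the error exceeds `2 ^ m` when `e` qubits are erased. -/
noncomputable def converseTerm (m e : ℕ) : ℝ :=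
  if m / 2 < e then 1 - 2 ^ m / 4 ^ e else 0

/-- The mean of `min 1 ((J - 1) / 2 ^ m)`, where `J` is the position of the error, when `e` qubits
are erased. -/
noncomputable def achievabilityTerm (m e : ℕ) : ℝ :=
  if m / 2 < e then 1 - (2 ^ m + 1) / 2 / 4 ^ e else (4 ^ e - 1) / 2 ^ (m + 1)

variable {n : ℕ} {δ : ℝ} (hδ : δ ∈ Set.Icc (0 : ℝ) 1)
  {ord : (Fin n → ZMod 2) → Fin (2 ^ (2 * n)) ≃ PauliVec n}

theorem erasureNoise_converseBound (hord : (erasureNoise n δ hδ).IsSorting ord) (k : ℕ) :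
    (erasureNoise n δ hδ).converseBound ord k = binomialMean n δ (converseTerm (n - k)) := by
  rw [PauliNoise.converseBound, PauliNoise.probOf_eq_expect]
  refine (erasureNoise_expect_position hδ hord fun j => if 2 ^ (n - k) < j + 1 then 1 else 0).trans
    (binomialMean_congr fun e _ => ?_)
  rw [sum_range_ite_lt_succ, converseTerm]
  split_ifs with h
  · rw [Nat.cast_sub (two_pow_le_four_pow h)]
    push_cast
    field_simp
  · rw [Nat.sub_eq_zero_of_le (four_pow_le_two_pow h), Nat.cast_zero, zero_div]

theorem erasureNoise_achievabilityBound (hord : (erasureNoise n δ hδ).IsSorting ord) (k : ℕ) :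
    (erasureNoise n δ hδ).achievabilityBound ord k =
      binomialMean n δ (achievabilityTerm (n - k)) := by
  rw [PauliNoise.achievabilityBound_eq_expect]
  refine (erasureNoise_expect_position hδ hord fun j => min 1 ((j : ℝ) / 2 ^ (n - k))).trans
    (binomialMean_congr fun e _ => ?_)
  rw [achievabilityTerm]
  split_ifs with h
  · have hsum := sum_range_min_one_div_of_ge (F := ℝ) (Nat.two_pow_pos _) (two_pow_le_four_pow h)
    push_cast at hsum
    rw [hsum]
    field_simp
  · have hsum := sum_range_min_one_div_of_le (F := ℝ) (four_pow_le_two_pow h)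
    push_cast at hsum
    rw [hsum, pow_succ]
    field_simp

end ErasureBounds

section ClosedForms

theorem binomialCDF_eq_binomialMean (n : ℕ) (q : ℝ) (i : ℤ) :
    binomialCDF n q i = binomialMean n q fun j => if (j : ℤ) ≤ i then 1 else 0 := by
  simp only [binomialCDF, binomialMean, mul_ite, mul_one, mul_zero, ← Finset.sum_filter]
  symm
  refine Finset.sum_subset (fun j hj => ?_) fun j hj hj' => ?_
  · rw [Finset.mem_filter] at hj
    exact Finset.mem_range.2 (by omega)
  · rw [Finset.mem_filter, Finset.mem_range, not_and'] at hj'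
    have hnj : n < j := by
      have := hj' (by have := Finset.mem_range.1 hj; omega)
      omega
    rw [Nat.choose_eq_zero_of_lt hnj, Nat.cast_zero, zero_mul, zero_mul]

theorem binomialMean_tail_eq_binomialCDF (n M : ℕ) (p : ℝ) :
    binomialMean n p (fun j => if M < j then 1 else 0) =
      binomialCDF n (1 - p) ((n : ℤ) - (M : ℕ) - 1) := by
  rw [binomialCDF_eq_binomialMean, ← binomialMean_reflect]
  exact binomialMean_congr fun j hj => if_congr (by omega) rfl rfl

variable {δ : ℝ}

theorem binomialMean_tail_div_four_pow (n M : ℕ) (hδ : δ ≤ 1) :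
    binomialMean n δ (fun e => (1 / 4) ^ e * if M < e then 1 else 0) =
      ((4 - 3 * δ) / 4) ^ n *
        binomialCDF n ((4 - 4 * δ) / (4 - 3 * δ)) ((n : ℤ) - (M : ℕ) - 1) := by
  have hpos : 0 < 4 - 3 * δ := by linarith
  have mgf : 1 - δ + δ * (1 / 4) = (4 - 3 * δ) / 4 := by ring
  have tilt : 1 - δ * (1 / 4) / ((4 - 3 * δ) / 4) = (4 - 4 * δ) / (4 - 3 * δ) := by
    rw [eq_div_iff hpos.ne', sub_mul]
    field_simp
    ring
  rw [binomialMean_pow_mul n (by rw [mgf]; positivity), binomialMean_tail_eq_binomialCDF, mgf, tilt]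

theorem binomialMean_head_mul_four_pow (n M : ℕ) (hδ : 0 ≤ δ) :
    binomialMean n δ (fun e => 4 ^ e * if M < e then 0 else 1) =
      (1 + 3 * δ) ^ n * binomialCDF n (4 * δ / (1 + 3 * δ)) (M : ℤ) := by
  have mgf : 1 - δ + δ * 4 = 1 + 3 * δ := by ring
  rw [binomialMean_pow_mul n (by rw [mgf]; positivity), binomialCDF_eq_binomialMean, mgf,
    mul_comm δ 4]
  congr 1
  exact binomialMean_congr fun j _ => by rw [← ite_not]; exact if_congr (by omega) rfl rfl

theorem binomialMean_converseTerm (n m : ℕ) (hδ : δ ≤ 1) :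
    binomialMean n δ (converseTerm m) =
      binomialCDF n (1 - δ) ((n : ℤ) - (m / 2 : ℕ) - 1)
        - 2 ^ m * ((4 - 3 * δ) / 4) ^ n *
          binomialCDF n ((4 - 4 * δ) / (4 - 3 * δ)) ((n : ℤ) - (m / 2 : ℕ) - 1) := by
  rw [mul_assoc, ← binomialMean_tail_div_four_pow n _ hδ, ← binomialMean_tail_eq_binomialCDF,
    ← binomialMean_const_mul, ← binomialMean_sub]
  refine binomialMean_congr fun e _ => ?_
  rw [converseTerm]
  split_ifs
  · rw [div_pow]; ring
  · ring

theorem binomialMean_achievabilityTerm (n m : ℕ) (hδ : δ ∈ Set.Icc (0 : ℝ) 1) :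
    binomialMean n δ (achievabilityTerm m) =
      (1 + 1 / 2 ^ (m + 1)) * binomialCDF n (1 - δ) ((n : ℤ) - (m / 2 : ℕ) - 1)
        - 1 / 2 ^ (m + 1)
        - (2 ^ m + 1) / 2 * ((4 - 3 * δ) / 4) ^ n *
          binomialCDF n ((4 - 4 * δ) / (4 - 3 * δ)) ((n : ℤ) - (m / 2 : ℕ) - 1)
        + (1 + 3 * δ) ^ n / 2 ^ (m + 1) *
          binomialCDF n (4 * δ / (1 + 3 * δ)) ((m / 2 : ℕ) : ℤ) := by
  have decompose : binomialMean n δ (achievabilityTerm m) = binomialMean n δ fun e =>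
      (1 + 1 / 2 ^ (m + 1)) * (if m / 2 < e then 1 else 0) - 1 / 2 ^ (m + 1)
        - (2 ^ m + 1) / 2 * ((1 / 4) ^ e * if m / 2 < e then 1 else 0)
        + 1 / 2 ^ (m + 1) * (4 ^ e * if m / 2 < e then 0 else 1) := by
    refine binomialMean_congr fun e _ => ?_
    rw [achievabilityTerm]
    split_ifs
    · rw [div_pow]; ring
    · ring
  rw [decompose, binomialMean_add, binomialMean_sub, binomialMean_sub, binomialMean_const_mul,
    binomialMean_const_mul, binomialMean_const_mul, binomialMean_const,
    binomialMean_tail_eq_binomialCDF, binomialMean_tail_div_four_pow n _ hδ.2,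
    binomialMean_head_mul_four_pow n _ hδ.1]
  ring

end ClosedForms

/-! ### Random isometries of an alternating form -/

theorem card_ker_mul_card_of_surjective {V U : Type*} [AddGroup V] [AddGroup U] [Fintype V]
    [Fintype U] [DecidableEq U] {L : V →+ U} (hL : Function.Surjective L) :
    (Finset.univ.filter fun v => L v = 0).card * Fintype.card U = Fintype.card V := by
  have h := L.ker.card_mul_index
  rw [AddSubgroup.index_ker, AddMonoidHom.range_eq_top.2 hL, Nat.card_eq_fintype_card (α := V),
    AddSubgroup.card_top, Nat.card_eq_fintype_card (α := U)] at h
  have card_ker : Nat.card L.ker = (Finset.univ.filter fun v => L v = 0).card :=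
    Nat.subtype_card _ fun v => by simp [AddMonoidHom.mem_ker]
  rw [← h, card_ker]

section TransitiveAction

variable {G V U : Type*} [Group G] [Fintype G] [AddGroup V] [DistribMulAction G V]

theorem card_smul_eq_of_transitive [DecidableEq V] {x w : V} (hw : ∃ g : G, g • x = w) :
    (Finset.univ.filter fun g : G => g • x = w).card =
      (Finset.univ.filter fun g : G => g • x = x).card := by
  obtain ⟨h, rfl⟩ := hw
  refine Finset.card_equiv (Equiv.mulLeft h⁻¹) fun g => ?_
  simp [mul_smul, inv_smul_eq_iff]

theorem card_smul_mem_of_transitive [DecidableEq V] {x : V}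
    (htrans : ∀ w ≠ 0, ∃ g : G, g • x = w) {S : Finset V} (hS : 0 ∉ S) :
    (Finset.univ.filter fun g : G => g • x ∈ S).card =
      S.card * (Finset.univ.filter fun g : G => g • x = x).card := by
  rw [← Finset.sum_card_fiberwise_eq_card_filter, ← smul_eq_mul, ← Finset.sum_const]
  exact Finset.sum_congr rfl fun w hw =>
    card_smul_eq_of_transitive (htrans w (ne_of_mem_of_not_mem hw hS))

variable [Finite V] [AddGroup U] [Fintype U] [DecidableEq U]

/-- The image of a nonzero vector under a random group element is uniform on the nonzero vectors,
of which the kernel of `L` contains a smaller fraction than of all vectors. -/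
theorem card_map_smul_eq_zero_mul_card_le {x : V} (hx : x ≠ 0)
    (htrans : ∀ w ≠ 0, ∃ g : G, g • x = w) {L : V →+ U} (hL : Function.Surjective L) :
    (Finset.univ.filter fun g : G => L (g • x) = 0).card * Fintype.card U ≤ Fintype.card G := by
  classical
  have := Fintype.ofFinite V
  set N := (Finset.univ.filter fun g : G => g • x = x).card
  set ker := Finset.univ.filter fun v => L v = 0
  have ne_zero (g : G) : g • x ≠ 0 := (smul_ne_zero_iff_ne g).2 hx
  have card_kernel : (Finset.univ.filter fun g : G => L (g • x) = 0).card = (ker.card - 1) * N := by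
    rw [← Finset.card_erase_of_mem (show (0 : V) ∈ ker by simp [ker]),
      ← card_smul_mem_of_transitive htrans (Finset.notMem_erase 0 ker)]
    simp [ker, ne_zero]
  have card_group : Fintype.card G = (Fintype.card V - 1) * N := by
    rw [← Finset.card_univ (α := V), ← Finset.card_erase_of_mem (Finset.mem_univ (0 : V)),
      ← card_smul_mem_of_transitive htrans (Finset.notMem_erase 0 Finset.univ)]
    simp [ne_zero]
  have card_U_pos : 0 < Fintype.card U := Fintype.card_pos
  rw [card_kernel, card_group, ← card_ker_mul_card_of_surjective hL, mul_right_comm,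
    Nat.sub_one_mul]
  gcongr
  omega

end TransitiveAction

section AlternatingForm

variable {K V : Type*} [Field K] [AddCommGroup V] [Module K V]

/-- The group of linear automorphisms that preserve a bilinear form; for a nondegenerate
alternating form this is the symplectic group. -/
def isometryGroup (B : LinearMap.BilinForm K V) : Subgroup (V ≃ₗ[K] V) where
  carrier := {T | ∀ x y, B (T x) (T y) = B x y}
  one_mem' _ _ := rfl
  mul_mem' hS hT x y := (hS _ _).trans (hT x y)
  inv_mem' {T} hT x y := by
    rw [← hT]
    exact congrArg₂ (B · ·) (T.apply_symm_apply x) (T.apply_symm_apply y)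

variable {B : LinearMap.BilinForm K V}

/-- The witness is the transvection along `w - u`. -/
theorem exists_isometry_apply_eq_of_ne_zero (hB : B.IsAlt) {u w : V} (huw : B w u ≠ 0) :
    ∃ T ∈ isometryGroup B, T u = w := by
  have alt : ((B w u)⁻¹ • B (w - u)) (w - u) = 0 := by
    rw [LinearMap.smul_apply, hB.self_eq_zero, smul_zero]
  refine ⟨LinearEquiv.transvection alt, fun x y => ?_, ?_⟩
  · have hneg : B x (w - u) = -B (w - u) x := (hB.neg_eq _ _).symm
    simp only [LinearEquiv.transvection.apply, LinearMap.smul_apply, map_add, map_smul,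
      LinearMap.add_apply, smul_eq_mul, hB.self_eq_zero, hneg]
    ring
  · rw [LinearEquiv.transvection.apply, LinearMap.smul_apply, map_sub, LinearMap.sub_apply,
      hB.self_eq_zero, sub_zero, smul_eq_mul, inv_mul_cancel₀ huw, one_smul, add_sub_cancel]

theorem exists_apply_ne_zero_and_apply_ne_zero (hB : B.SeparatingLeft) {u w : V} (hu : u ≠ 0)
    (hw : w ≠ 0) : ∃ z, B u z ≠ 0 ∧ B w z ≠ 0 := by
  obtain ⟨a, ha⟩ := not_forall.1 (mt (hB u) hu)
  obtain ⟨b, hb⟩ := not_forall.1 (mt (hB w) hw)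
  by_cases hwa : B w a = 0
  · by_cases hub : B u b = 0
    · exact ⟨a + b, by simpa [hub] using ha, by simpa [hwa] using hb⟩
    · exact ⟨b, hub, hb⟩
  · exact ⟨a, ha, hwa⟩

theorem exists_isometry_apply_eq (halt : B.IsAlt) (hsep : B.SeparatingLeft) {u w : V} (hu : u ≠ 0)
    (hw : w ≠ 0) : ∃ T : isometryGroup B, T • u = w := by
  obtain ⟨z, huz, hwz⟩ := exists_apply_ne_zero_and_apply_ne_zero hsep hu hw
  have hzu : B z u ≠ 0 := by rwa [← halt.neg_eq, neg_ne_zero]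
  obtain ⟨S, hS, rfl⟩ := exists_isometry_apply_eq_of_ne_zero halt hzu
  obtain ⟨T, hT, rfl⟩ := exists_isometry_apply_eq_of_ne_zero halt hwz
  exact ⟨⟨T, hT⟩ * ⟨S, hS⟩, rfl⟩

end AlternatingForm

section Symplectic

variable {n : ℕ}

/-- The symplectic form `xᵀ R y`, `R` the reverse diagonal, which `symplecticMatrices` preserve. -/
def revForm (n : ℕ) : LinearMap.BilinForm (ZMod 2) (PauliVec n) :=
  (revDiag (2 * n)).toBilin'

theorem revForm_apply (x y : PauliVec n) : revForm n x y = ∑ i, x i * y (Fin.rev i) := by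
  simp [revForm, Matrix.toBilin'_apply, revDiag]

theorem isAlt_revForm : (revForm n).IsAlt := by
  intro x
  rw [revForm_apply]
  refine Finset.sum_involution (fun i _ => Fin.rev i) (fun i _ => ?_) (fun i _ _ h => ?_)
    (fun i _ => Finset.mem_univ _) (fun i _ => Fin.rev_rev i)
  · rw [Fin.rev_rev, mul_comm (x (Fin.rev i))]
    exact CharTwo.add_self_eq_zero _
  · have := congrArg Fin.val h
    rw [Fin.val_rev] at this
    omega

theorem separatingLeft_revForm : (revForm n).SeparatingLeft := by
  intro x hx
  funext i
  simpa [revForm_apply, Pi.single_apply, Fin.rev_inj] using hx (Pi.single (Fin.rev i) 1)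

theorem toMatrix'_mem_symplecticMatrices {T : PauliVec n ≃ₗ[ZMod 2] PauliVec n}
    (hT : T ∈ isometryGroup (revForm n)) :
    LinearMap.toMatrix' (T : PauliVec n →ₗ[ZMod 2] PauliVec n) ∈ symplecticMatrices n := by
  have preserved : (revForm n).comp (T : PauliVec n →ₗ[ZMod 2] PauliVec n) T = revForm n :=
    LinearMap.ext₂ hT
  have h := LinearMap.BilinForm.toMatrix'_comp (revForm n)
    (T : PauliVec n →ₗ[ZMod 2] PauliVec n) (T : PauliVec n →ₗ[ZMod 2] PauliVec n)
  rw [preserved, revForm, LinearMap.BilinForm.toMatrix'_toBilin'] at h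
  exact h.symm

theorem syndrome_sub (k : ℕ) (C : Matrix (Fin (2 * n)) (Fin (2 * n)) (ZMod 2))
    (u w : PauliVec n) : syndrome k C (u - w) = syndrome k C u - syndrome k C w := by
  funext i
  simp only [syndrome, Matrix.mulVec_sub, Pi.sub_apply]

noncomputable instance : Fintype (isometryGroup (revForm n)) :=
  have : Finite (PauliVec n ≃ₗ[ZMod 2] PauliVec n) := DFunLike.finite _
  Fintype.ofFinite _

theorem card_isometry_syndrome_eq_zero_mul_le (k : ℕ) {x : PauliVec n} (hx : x ≠ 0) :
    (Finset.univ.filter fun T : isometryGroup (revForm n) =>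
      syndrome k (LinearMap.toMatrix' (T : PauliVec n →ₗ[ZMod 2] PauliVec n)) x = 0).card *
        2 ^ (n - k) ≤ Fintype.card (isometryGroup (revForm n)) := by
  have hcast : n - k ≤ 2 * n := by omega
  have hL := LinearMap.funLeft_surjective_of_injective (ZMod 2) (ZMod 2) _
    (Fin.castLE_injective hcast)
  have h := card_map_smul_eq_zero_mul_card_le (G := isometryGroup (revForm n)) hx
    (fun w hw => exists_isometry_apply_eq isAlt_revForm separatingLeft_revForm hx hw)
    (L := (LinearMap.funLeft (ZMod 2) (ZMod 2) (Fin.castLE hcast)).toAddMonoidHom) hL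
  rw [Fintype.card_fun, ZMod.card, Fintype.card_fin] at h
  have syndrome_eq (T : isometryGroup (revForm n)) :
      syndrome k (LinearMap.toMatrix' (T : PauliVec n →ₗ[ZMod 2] PauliVec n)) x =
        LinearMap.funLeft (ZMod 2) (ZMod 2) (Fin.castLE hcast) (T • x) :=
    funext fun i => congrFun (LinearMap.toMatrix'_mulVec _ x) _
  simp only [syndrome_eq]
  exact h

end Symplectic

/-! ### One-shot bounds on the guessing probability -/

theorem sum_le_sum_of_card_le {ι M : Type*} [AddCommMonoid M] [LinearOrder M]
    [IsOrderedCancelAddMonoid M] {S I : Finset ι} {f : ι → M} (hf : ∀ i, 0 ≤ f i)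
    (hI : ∀ i ∈ I, ∀ j ∉ I, f j ≤ f i) (hcard : S.card ≤ I.card) :
    ∑ i ∈ S, f i ≤ ∑ i ∈ I, f i := by
  classical
  rcases (S \ I).eq_empty_or_nonempty with hempty | hne
  · exact Finset.sum_le_sum_of_subset_of_nonneg (Finset.sdiff_eq_empty_iff_subset.1 hempty)
      fun i _ _ => hf i
  obtain ⟨j, hj, hmax⟩ := Finset.exists_max_image (S \ I) f hne
  rw [← Finset.sum_sdiff_le_sum_sdiff]
  calc ∑ i ∈ S \ I, f i ≤ (S \ I).card • f j := Finset.sum_le_card_nsmul _ _ _ hmax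
    _ ≤ (I \ S).card • f j :=
        nsmul_le_nsmul_left (hf j) (Finset.card_sdiff_le_card_sdiff_iff.2 hcard)
    _ ≤ ∑ i ∈ I \ S, f i := Finset.card_nsmul_le_sum _ _ _ fun i hi =>
        hI i (Finset.mem_sdiff.1 hi).1 j (Finset.mem_sdiff.1 hj).2

theorem card_filter_apply_apply_eq_le {α β : Type*} [Fintype α] [DecidableEq α] [Fintype β]
    (s : α → β) (d : β → α) :
    (Finset.univ.filter fun a => d (s a) = a).card ≤ Fintype.card β :=
  Finset.card_le_card_of_injOn s (fun _ _ => Finset.mem_coe.2 (Finset.mem_univ _))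
    fun a ha b hb h => by
      rw [← (Finset.mem_filter.1 ha).2, ← (Finset.mem_filter.1 hb).2, h]

namespace PauliNoise

theorem card_position_le {n : ℕ} {V : Type*} (ord : V → Fin (2 ^ (2 * n)) ≃ PauliVec n) (v : V)
    {M : ℕ} (hM : M ≤ 2 ^ (2 * n)) :
    (Finset.univ.filter fun u => position ord u v ≤ M).card = M := by
  calc (Finset.univ.filter fun u => position ord u v ≤ M).card
      = (Finset.univ.filter fun j : Fin (2 ^ (2 * n)) => (j : ℕ) < M).card :=
        Finset.card_equiv (ord v).symm fun u => by simp [position]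
    _ = M := by rw [Fin.card_filter_val_lt, min_eq_right hM]

section Converse

variable {n : ℕ} {V : Type*} [Fintype V]

theorem probOf_not (p : PauliNoise n V) (E : PauliVec n → V → Prop) :
    p.probOf (fun u v => ¬E u v) = 1 - p.probOf E := by
  classical
  rw [eq_sub_iff_add_eq, ← p.sum_mass]
  simp only [probOf, ← Finset.sum_add_distrib]
  refine Finset.sum_congr rfl fun u _ => Finset.sum_congr rfl fun v _ => ?_
  by_cases h : E u v <;> simp [h]

theorem IsSorting.mass_le_of_position_le {p : PauliNoise n V}
    {ord : V → Fin (2 ^ (2 * n)) ≃ PauliVec n} (hord : p.IsSorting ord) {u w : PauliVec n} {v : V}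
    (h : position ord u v ≤ position ord w v) : p.mass w v ≤ p.mass u v := by
  simpa using hord v (Fin.le_def.2 (Nat.le_of_succ_le_succ h))

/-- Given `V`, a decoder guesses correctly at most one error for each of the `2 ^ m` syndromes. -/
theorem converseBound_le_wrongGuessProb (p : PauliNoise n V)
    {ord : V → Fin (2 ^ (2 * n)) ≃ PauliVec n} (hord : p.IsSorting ord) (k : ℕ)
    (C : Matrix (Fin (2 * n)) (Fin (2 * n)) (ZMod 2))
    (D : V → (Fin (n - k) → ZMod 2) → PauliVec n) :
    p.converseBound ord k ≤ p.wrongGuessProb k C D := by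
  classical
  have hM : 2 ^ (n - k) ≤ 2 ^ (2 * n) := Nat.pow_le_pow_right two_pos (by omega)
  have converse_eq :
      p.converseBound ord k = 1 - p.probOf fun u v => position ord u v ≤ 2 ^ (n - k) := by
    rw [← probOf_not, converseBound]
    simp only [not_le]
  rw [converse_eq, wrongGuessProb, probOf_not p fun u v => D v (syndrome k C u) = u]
  refine sub_le_sub_left ?_ 1
  rw [probOf, probOf]
  refine (Finset.sum_comm.trans_le (Finset.sum_le_sum fun v _ => ?_)).trans_eq Finset.sum_comm
  have card_guessed := card_filter_apply_apply_eq_le (syndrome k C) (D v)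
  rw [Fintype.card_fun, ZMod.card, Fintype.card_fin, ← card_position_le ord v hM] at card_guessed
  have h := sum_le_sum_of_card_le (fun u => p.mass_nonneg u v) (fun u hu w hw => ?_) card_guessed
  · rw [Finset.sum_filter, Finset.sum_filter] at h
    convert h
  · simp only [Finset.mem_filter_univ, not_le] at hu hw
    exact hord.mass_le_of_position_le (hu.trans hw.le)

end Converse

section Achievability

variable {n : ℕ} {V : Type*}

/-- The decoder picks the most likely error with the given syndrome. -/
theorem exists_decoder (ord : V → Fin (2 ^ (2 * n)) ≃ PauliVec n) (k : ℕ)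
    (C : Matrix (Fin (2 * n)) (Fin (2 * n)) (ZMod 2)) :
    ∃ D : V → (Fin (n - k) → ZMod 2) → PauliVec n, ∀ u v, D v (syndrome k C u) ≠ u →
      ∃ j < (ord v).symm u, syndrome k C (ord v j - u) = 0 := by
  have exists_first (v : V) (s : Fin (n - k) → ZMod 2) : ∃ w : PauliVec n,
      ∀ u, syndrome k C u = s → syndrome k C w = s ∧ (ord v).symm w ≤ (ord v).symm u := by
    rcases (Finset.univ.filter fun u => syndrome k C u = s).eq_empty_or_nonempty with h | h
    · exact ⟨0, fun u hu => absurd hu (Finset.filter_eq_empty_iff.1 h (Finset.mem_univ u))⟩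
    · obtain ⟨w, hw, hmin⟩ := Finset.exists_min_image _ (ord v).symm h
      simp only [Finset.mem_filter_univ] at hw hmin
      exact ⟨w, fun u hu => ⟨hw, hmin u hu⟩⟩
  choose D hD using exists_first
  refine ⟨D, fun u v hne => ?_⟩
  obtain ⟨same_syndrome, le⟩ := hD v _ u rfl
  refine ⟨_, le.lt_of_ne fun h => hne ((ord v).symm.injective h), ?_⟩
  rw [Equiv.apply_symm_apply, syndrome_sub, same_syndrome, sub_self]

theorem card_isometry_exists_syndrome_eq_zero_mul_le (k : ℕ) {S : Finset (PauliVec n)}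
    (hS : 0 ∉ S) :
    (Finset.univ.filter fun T : isometryGroup (revForm n) => ∃ x ∈ S,
      syndrome k (LinearMap.toMatrix' (T : PauliVec n →ₗ[ZMod 2] PauliVec n)) x = 0).card *
        2 ^ (n - k) ≤ S.card * Fintype.card (isometryGroup (revForm n)) := by
  classical
  rw [← smul_eq_mul S.card, ← Finset.sum_const]
  calc _ ≤ (∑ x ∈ S, _) * 2 ^ (n - k) := by
        gcongr
        refine (Finset.card_le_card fun T hT => ?_).trans Finset.card_biUnion_le
        rw [Finset.mem_biUnion]
        obtain ⟨x, hx, h⟩ := (Finset.mem_filter_univ T).1 hT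
        exact ⟨x, hx, (Finset.mem_filter_univ T).2 h⟩
    _ = ∑ x ∈ S, _ * 2 ^ (n - k) := Finset.sum_mul ..
    _ ≤ _ := Finset.sum_le_sum fun x hx =>
        card_isometry_syndrome_eq_zero_mul_le k (ne_of_mem_of_not_mem hx hS)

theorem card_isometry_exists_lt_le (k : ℕ) (e : Fin (2 ^ (2 * n)) ≃ PauliVec n)
    (i : Fin (2 ^ (2 * n))) :
    ((Finset.univ.filter fun T : isometryGroup (revForm n) => ∃ j < i,
      syndrome k (LinearMap.toMatrix' (T : PauliVec n →ₗ[ZMod 2] PauliVec n)) (e j - e i) =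
        0).card : ℝ) ≤
      Fintype.card (isometryGroup (revForm n)) * min 1 ((i : ℕ) / (2 : ℝ) ^ (n - k)) := by
  classical
  set S := (Finset.Iio i).image fun j => e j - e i
  have zero_notMem : 0 ∉ S := by
    simp only [S, Finset.mem_image, Finset.mem_Iio, sub_eq_zero, not_exists, not_and]
    exact fun j hj h => hj.ne (e.injective h)
  have card_S : S.card ≤ (i : ℕ) := Finset.card_image_le.trans_eq (Fin.card_Iio _)
  have union_bound := (card_isometry_exists_syndrome_eq_zero_mul_le k zero_notMem).trans
    (Nat.mul_le_mul_right _ card_S)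
  simp only [S, Finset.exists_mem_image, Finset.mem_Iio] at union_bound
  rw [mul_min_of_nonneg _ _ (Nat.cast_nonneg _), mul_one, le_min_iff, mul_div_assoc',
    le_div_iff₀ (by positivity), mul_comm (Fintype.card _ : ℝ)]
  exact ⟨mod_cast Finset.card_le_univ _, mod_cast union_bound⟩

variable [Fintype V]

theorem exists_probOf_le_expect {ι : Type*} [Fintype ι] [Nonempty ι] (p : PauliNoise n V)
    {E : ι → PauliVec n → V → Prop} [∀ i u v, Decidable (E i u v)] {f : PauliVec n → V → ℝ}
    (h : ∀ u v, ((Finset.univ.filter fun i => E i u v).card : ℝ) ≤ Fintype.card ι * f u v) :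
    ∃ i, p.probOf (E i) ≤ p.expect f := by
  have sum_le : ∑ i, p.probOf (E i) ≤ ∑ _i : ι, p.expect f := by
    calc ∑ i, p.probOf (E i)
        = ∑ u, ∑ v, p.mass u v * ((Finset.univ.filter fun i => E i u v).card : ℝ) := by
          simp only [probOf_eq_expect, expect]
          rw [Finset.sum_comm]
          refine Finset.sum_congr rfl fun u _ => ?_
          rw [Finset.sum_comm]
          refine Finset.sum_congr rfl fun v _ => ?_
          rw [← Finset.mul_sum, Finset.sum_boole]
      _ ≤ ∑ u, ∑ v, p.mass u v * (Fintype.card ι * f u v) :=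
          Finset.sum_le_sum fun u _ => Finset.sum_le_sum fun v _ =>
            mul_le_mul_of_nonneg_left (h u v) (p.mass_nonneg u v)
      _ = ∑ _i : ι, p.expect f := by
          simp only [Finset.sum_const, Finset.card_univ, nsmul_eq_mul, expect, Finset.mul_sum,
            mul_left_comm]
  obtain ⟨i, -, hi⟩ := Finset.exists_le_of_sum_le Finset.univ_nonempty sum_le
  exact ⟨i, hi⟩

/-- The guarantee holds on average over a uniformly random symplectic matrix. -/
theorem exists_wrongGuessProb_le_achievabilityBound (p : PauliNoise n V)
    (ord : V → Fin (2 ^ (2 * n)) ≃ PauliVec n) (k : ℕ) :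
    ∃ C ∈ symplecticMatrices n, ∃ D : V → (Fin (n - k) → ZMod 2) → PauliVec n,
      p.wrongGuessProb k C D ≤ p.achievabilityBound ord k := by
  classical
  choose D hD using exists_decoder ord k
  let C (T : isometryGroup (revForm n)) :=
    LinearMap.toMatrix' (T : PauliVec n →ₗ[ZMod 2] PauliVec n)
  have few_wrong (u : PauliVec n) (v : V) :
      ((Finset.univ.filter fun T => D (C T) v (syndrome k (C T) u) ≠ u).card : ℝ) ≤
        Fintype.card (isometryGroup (revForm n)) *
          min 1 (((ord v).symm u : ℕ) / (2 : ℝ) ^ (n - k)) := by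
    refine le_trans (Nat.cast_le.2 (Finset.card_le_card fun T hT => ?_))
      (card_isometry_exists_lt_le k (ord v) ((ord v).symm u))
    rw [Finset.mem_filter_univ] at hT ⊢
    rw [Equiv.apply_symm_apply]
    exact hD (C T) u v hT
  obtain ⟨T, hT⟩ := p.exists_probOf_le_expect few_wrong
  exact ⟨C T, toMatrix'_mem_symplecticMatrices T.2, D (C T),
    hT.trans_eq (p.achievabilityBound_eq_expect ord k).symm⟩

end Achievability

section Rates

variable {n : ℕ} {V : Type*} [Fintype V] (p : PauliNoise n V) (ε : ℝ)

theorem finite_guessableRates : (p.guessableRates ε).Finite := by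
  refine ((Set.finite_Iic n).image fun k : ℕ => (k : ℝ) / n).subset ?_
  rintro r ⟨k, hk, rfl, -⟩
  exact Set.mem_image_of_mem _ hk

variable {p ε} in
theorem isGreatest_errorGuessRate (h : (p.guessableRates ε).Nonempty) :
    IsGreatest (p.guessableRates ε) (p.errorGuessRate ε) :=
  ⟨h.csSup_mem (p.finite_guessableRates ε), fun _ hr =>
    le_csSup (p.finite_guessableRates ε).bddAbove hr⟩

end Rates

end PauliNoise

section ErasureRates

variable {n : ℕ} {δ ε : ℝ} (hδ : δ ∈ Set.Icc (0 : ℝ) 1)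

theorem mem_guessableRates_erasureNoise {k : ℕ} (hk : k ≤ n)
    (h : binomialMean n δ (achievabilityTerm (n - k)) ≤ ε) :
    (k : ℝ) / n ∈ (erasureNoise n δ hδ).guessableRates ε := by
  obtain ⟨ord, hord⟩ := (erasureNoise n δ hδ).exists_isSorting
  obtain ⟨C, hC, D, hD⟩ :=
    (erasureNoise n δ hδ).exists_wrongGuessProb_le_achievabilityBound ord k
  rw [erasureNoise_achievabilityBound hδ hord] at hD
  exact ⟨k, hk, rfl, C, hC, D, hD.trans h⟩

theorem exists_of_mem_guessableRates_erasureNoise {r : ℝ}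
    (h : r ∈ (erasureNoise n δ hδ).guessableRates ε) :
    ∃ k ≤ n, r = (k : ℝ) / n ∧ binomialMean n δ (converseTerm (n - k)) ≤ ε := by
  obtain ⟨ord, hord⟩ := (erasureNoise n δ hδ).exists_isSorting
  obtain ⟨k, hk, rfl, C, -, D, hD⟩ := h
  refine ⟨k, hk, rfl, ?_⟩
  rw [← erasureNoise_converseBound hδ hord]
  exact ((erasureNoise n δ hδ).converseBound_le_wrongGuessProb hord k C D).trans hD

end ErasureRates

/-! ### The optimal rate -/

section CriticalParameter

theorem binomialMean_half_le_half {n : ℕ} {g : ℕ → ℝ} (hg : ∀ j ≤ n, g j + g (n - j) ≤ 1) :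
    binomialMean n (1 / 2) g ≤ 1 / 2 := by
  have half : (1 / 2 : ℝ) ∈ Set.Icc 0 1 := by norm_num
  have reflect := binomialMean_reflect n (1 / 2 : ℝ) g
  rw [sub_half] at reflect
  have sum_le := binomialMean_mono half hg
  rw [binomialMean_add, reflect, binomialMean_const] at sum_le
  linarith

theorem achievabilityTerm_add_reflect_le_of_lt {n e : ℕ} (hen : e ≤ n) (h : n / 2 < e) :
    achievabilityTerm n e + achievabilityTerm n (n - e) ≤ 1 := by
  have four_pow : (4 : ℝ) ^ (n - e) = 2 ^ n * 2 ^ n / 4 ^ e := by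
    rw [eq_div_iff (by positivity), ← pow_add, Nat.sub_add_cancel hen, ← mul_pow]
    norm_num
  rw [achievabilityTerm, if_pos h, achievabilityTerm, if_neg (by omega), four_pow]
  calc 1 - (2 ^ n + 1) / 2 / 4 ^ e + (2 ^ n * 2 ^ n / 4 ^ e - 1) / 2 ^ (n + 1)
      = 1 - (1 / (2 * 4 ^ e) + 1 / 2 ^ (n + 1) : ℝ) := by
        field_simp
        ring
    _ ≤ 1 := sub_le_self _ (by positivity)

theorem achievabilityTerm_add_reflect_le {n e : ℕ} (hen : e ≤ n) :
    achievabilityTerm n e + achievabilityTerm n (n - e) ≤ 1 := by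
  rcases lt_trichotomy n (2 * e) with h | rfl | h
  · exact achievabilityTerm_add_reflect_le_of_lt hen (by omega)
  · have half : achievabilityTerm (2 * e) e ≤ 1 / 2 := by
      rw [achievabilityTerm, if_neg (by omega), pow_succ, pow_mul,
        div_le_div_iff₀ (by positivity) two_pos]
      norm_num
    rw [show 2 * e - e = e by omega]
    linarith
  · have h' := achievabilityTerm_add_reflect_le_of_lt (Nat.sub_le n e) (by omega)
    rwa [Nat.sub_sub_self hen, add_comm] at h'

end CriticalParameter

section NormalApproximation

theorem two_pow_div_four_pow_le_of_lt {m e : ℕ} (h : m / 2 < e) :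
    (2 : ℝ) ^ m / 4 ^ e ≤ 2 * (1 / 4) ^ Nat.dist (m / 2) e := by
  rw [Nat.dist_eq_sub_of_le h.le, one_div_pow, mul_one_div,
    div_le_div_iff₀ (by positivity) (by positivity), show (4 : ℝ) = 2 ^ 2 by norm_num, ← pow_mul,
    ← pow_mul, ← pow_add, ← pow_succ']
  exact pow_le_pow_right₀ one_le_two (by omega)

theorem abs_converseTerm_sub_ite_le (m e : ℕ) :
    |converseTerm m e - if m / 2 < e then 1 else 0| ≤ 2 * (1 / 4) ^ Nat.dist (m / 2) e := by
  rw [converseTerm]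
  split_ifs with h
  · rw [sub_sub_cancel_left, abs_neg, abs_of_nonneg (by positivity)]
    exact two_pow_div_four_pow_le_of_lt h
  · rw [sub_zero, abs_zero]
    positivity

theorem abs_achievabilityTerm_sub_ite_le (m e : ℕ) :
    |achievabilityTerm m e - if m / 2 < e then 1 else 0| ≤
      2 * (1 / 4) ^ Nat.dist (m / 2) e := by
  rw [achievabilityTerm]
  split_ifs with h
  · rw [sub_sub_cancel_left, abs_neg, abs_of_nonneg (by positivity)]
    refine le_trans ?_ (two_pow_div_four_pow_le_of_lt h)
    gcongr
    linarith [one_le_pow₀ (one_le_two (α := ℝ)) (n := m)]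
  · have one_le : (1 : ℝ) ≤ 4 ^ e := one_le_pow₀ (by norm_num)
    rw [sub_zero, abs_of_nonneg (div_nonneg (sub_nonneg.2 one_le) (by positivity)),
      Nat.dist_eq_sub_of_le_right (not_lt.1 h), one_div_pow, mul_one_div,
      div_le_div_iff₀ (by positivity) (by positivity)]
    have pow_le : (4 : ℝ) ^ e * 4 ^ (m / 2 - e) ≤ 2 ^ (m + 1) := by
      rw [← pow_add, show (4 : ℝ) = 2 ^ 2 by norm_num, ← pow_mul]
      exact pow_le_pow_right₀ one_le_two (by omega)
    nlinarith [pow_pos (four_pos (α := ℝ)) (m / 2 - e), pow_pos (two_pos (α := ℝ)) (m + 1)]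

theorem abs_binomialMean_threshold_sub_le {n M : ℕ} {p s : ℝ} (hp : p ∈ Set.Icc (0 : ℝ) 1)
    (hs : 0 < s) (hvar : n * p * (1 - p) = s ^ 2) {g : ℕ → ℝ}
    (hg : ∀ e, |g e - if M < e then 1 else 0| ≤ 2 * (1 / 4) ^ Nat.dist M e) :
    |binomialMean n p g - (1 - normalCDF ((M - n * p) / s))| ≤ 21 / s := by
  refine (abs_binomialMean_sub_tail_le hp hs hvar two_pos.le (by norm_num) (by norm_num)
    fun e _ => hg e).trans ?_
  rw [mul_div_assoc', ← add_div]
  gcongr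
  norm_num

theorem exists_eventually_lt_map_add_div {f : ℝ → ℝ} {f' x : ℝ} (hf : HasDerivAt f f' x)
    (hf' : 0 < f') (C : ℝ) :
    ∃ b, ∀ᶠ s in atTop, f x + C / s < f (x + b / s) ∧ f (x - b / s) < f x - C / s := by
  set b := (C + 1) / f'
  have hbf : f' * b = C + 1 := mul_div_cancel₀ _ hf'.ne'
  have above := hf.hasFDerivAt.lim_real b
  have below := hf.hasFDerivAt.lim_real (-b)
  simp only [smul_eq_mul, ContinuousLinearMap.toSpanSingleton_apply, neg_mul, mul_neg,
    ← sub_eq_add_neg, inv_mul_eq_div, mul_comm b f', hbf] at above below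
  refine ⟨b, ?_⟩
  filter_upwards [above.eventually_const_lt (lt_add_one C),
    below.eventually_lt_const (neg_lt_neg (lt_add_one C)), eventually_gt_atTop 0]
    with s h₁ h₂ hs
  rw [← div_lt_iff₀' hs] at h₁
  rw [← lt_div_iff₀' hs, neg_div] at h₂
  constructor <;> linarith

theorem tendsto_mul_sqrt_natCast_atTop {c : ℝ} (hc : 0 < c) :
    Tendsto (fun n : ℕ => c * √(n : ℝ)) atTop atTop :=
  (Real.tendsto_sqrt_atTop.comp tendsto_natCast_atTop_atTop).const_mul_atTop hc

theorem tendsto_mul_natCast_add_mul_sqrt_atTop {c : ℝ} (hc : 0 < c) (d : ℝ) :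
    Tendsto (fun n : ℕ => c * n + d * √(n : ℝ)) atTop atTop := by
  have hsqrt : Tendsto (fun n : ℕ => √(n : ℝ)) atTop atTop :=
    Real.tendsto_sqrt_atTop.comp tendsto_natCast_atTop_atTop
  refine (hsqrt.atTop_mul_atTop₀ (tendsto_atTop_add_const_right _ d
    (tendsto_mul_sqrt_natCast_atTop hc))).congr fun n => ?_
  linear_combination c * Real.mul_self_sqrt n.cast_nonneg

end NormalApproximation

section OptimalRate

variable {δ ε : ℝ}

/-- `n δ - Φ⁻¹(ε) √(n δ (1 - δ))` is the approximate `(1 - ε)`-quantile of the number of erased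
qubits. -/
theorem exists_eventually_syndrome_length_bounds (hδ : δ ∈ Set.Ioo (0 : ℝ) 1)
    (hε : ε ∈ Set.Ioo (0 : ℝ) 1) :
    ∃ b, ∀ᶠ n : ℕ in atTop, ∀ m : ℕ,
      (n * δ - normalCDFInv ε * (√(δ * (1 - δ)) * √(n : ℝ)) + b ≤ (m / 2 : ℕ) →
        binomialMean n δ (achievabilityTerm m) ≤ ε) ∧
      (binomialMean n δ (converseTerm m) ≤ ε →
        n * δ - normalCDFInv ε * (√(δ * (1 - δ)) * √(n : ℝ)) - b ≤ (m / 2 : ℕ)) := by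
  set t := normalCDFInv ε
  have hσ : 0 < δ * (1 - δ) := mul_pos hδ.1 (sub_pos.2 hδ.2)
  obtain ⟨b, hb⟩ := exists_eventually_lt_map_add_div (hasDerivAt_normalCDF (-t))
    (by positivity) 21
  have hlim := tendsto_mul_sqrt_natCast_atTop (Real.sqrt_pos.2 hσ)
  refine ⟨b, ?_⟩
  filter_upwards [hlim.eventually hb, hlim.eventually_gt_atTop 0] with n ⟨above, below⟩ hs m
  set s := √(δ * (1 - δ)) * √(n : ℝ)
  have hvar : n * δ * (1 - δ) = s ^ 2 := by
    rw [mul_pow, Real.sq_sqrt hσ.le, Real.sq_sqrt n.cast_nonneg]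
    ring
  rw [normalCDF_neg, normalCDF_normalCDFInv hε] at above below
  have hδ' := Set.Ioo_subset_Icc_self hδ
  have ach := abs_le.1 (abs_binomialMean_threshold_sub_le hδ' hs hvar
    (abs_achievabilityTerm_sub_ite_le m))
  have conv := abs_le.1 (abs_binomialMean_threshold_sub_le hδ' hs hvar
    (abs_converseTerm_sub_ite_le m))
  constructor
  · intro h
    have le_deviation : -t + b / s ≤ ((m / 2 : ℕ) - n * δ) / s := by
      rw [le_div_iff₀ hs, add_mul, div_mul_cancel₀ _ hs.ne']
      linarith
    linarith [monotone_normalCDF le_deviation]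
  · intro h
    by_contra! hlt
    have deviation_le : ((m / 2 : ℕ) - n * δ) / s ≤ -t - b / s := by
      rw [div_le_iff₀ hs, sub_mul, div_mul_cancel₀ _ hs.ne']
      linarith
    linarith [monotone_normalCDF deviation_le]

/-- The second-order expansion of the optimal rate of guessing the error with error probability
`ε`. -/
noncomputable def secondOrderRate (δ ε : ℝ) (n : ℕ) : ℝ :=
  1 - 2 * δ + 2 * normalCDFInv ε * √(δ * (1 - δ)) / √(n : ℝ)

theorem natCast_mul_secondOrderRate (δ ε : ℝ) (n : ℕ) :
    n * secondOrderRate δ ε n =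
      (1 - 2 * δ) * n + 2 * normalCDFInv ε * √(δ * (1 - δ)) * √(n : ℝ) := by
  rw [secondOrderRate, mul_add, mul_div_left_comm, Real.div_sqrt, mul_comm (n : ℝ)]

theorem exists_eventually_guessable_rate_le (hδ : δ ∈ Set.Ioo (0 : ℝ) 1)
    (hε : ε ∈ Set.Ioo (0 : ℝ) 1) :
    ∃ K, ∀ᶠ n : ℕ in atTop,
      ∀ r ∈ (erasureNoise n δ (Set.Ioo_subset_Icc_self hδ)).guessableRates ε,
        r ≤ secondOrderRate δ ε n + K * (1 / n) := by
  obtain ⟨b, hb⟩ := exists_eventually_syndrome_length_bounds hδ hε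
  refine ⟨2 * b, ?_⟩
  filter_upwards [hb, eventually_gt_atTop 0] with n hb hn r hr
  obtain ⟨k, hk, rfl, hconv⟩ := exists_of_mem_guessableRates_erasureNoise _ hr
  have hn' : (0 : ℝ) < n := Nat.cast_pos.2 hn
  have length_ge := (hb (n - k)).2 hconv
  have two_mul_half_le : (2 : ℝ) * ((n - k) / 2 : ℕ) ≤ n - k := by
    rw [← Nat.cast_sub hk]
    exact_mod_cast Nat.mul_div_le (n - k) 2
  rw [mul_one_div, ← sub_le_iff_le_add, ← sub_div, div_le_iff₀' hn', natCast_mul_secondOrderRate]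
  linarith

theorem exists_eventually_exists_guessable_rate_ge (hδ : δ ∈ Set.Ioo (0 : ℝ) 1)
    (hε : ε ∈ Set.Ioo (0 : ℝ) 1) :
    ∃ K, ∀ᶠ n : ℕ in atTop, K ≤ n * secondOrderRate δ ε n →
      ∃ r ∈ (erasureNoise n δ (Set.Ioo_subset_Icc_self hδ)).guessableRates ε,
        secondOrderRate δ ε n - (K + 1) * (1 / n) ≤ r := by
  obtain ⟨b, hb⟩ := exists_eventually_syndrome_length_bounds hδ hε
  have hlim := tendsto_mul_natCast_add_mul_sqrt_atTop (mul_pos two_pos hδ.1)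
    (-(2 * normalCDFInv ε * √(δ * (1 - δ))))
  refine ⟨2 * b + 1, ?_⟩
  filter_upwards [hb, hlim.eventually_ge_atTop (-(2 * b + 1)), eventually_gt_atTop 0]
    with n hb hle hn hK
  have hn' : (0 : ℝ) < n := Nat.cast_pos.2 hn
  set k := ⌊n * secondOrderRate δ ε n - (2 * b + 1)⌋₊
  have k_le : (k : ℝ) ≤ _ := Nat.floor_le (sub_nonneg.2 hK)
  have lt_k_add_one : _ < (k : ℝ) + 1 := Nat.lt_floor_add_one _
  have k_le_n : k ≤ n := by
    rw [natCast_mul_secondOrderRate] at k_le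
    exact_mod_cast (by linarith : (k : ℝ) ≤ n)
  have le_two_mul_half : (n : ℝ) - k ≤ 2 * ((n - k) / 2 : ℕ) + 1 := by
    rw [← Nat.cast_sub k_le_n]
    exact_mod_cast (by omega : n - k ≤ 2 * ((n - k) / 2) + 1)
  refine ⟨(k : ℝ) / n, mem_guessableRates_erasureNoise _ k_le_n ((hb (n - k)).1 ?_), ?_⟩
  · rw [natCast_mul_secondOrderRate] at k_le
    linarith
  · rw [mul_one_div, sub_le_iff_le_add, ← add_div, le_div_iff₀' hn']
    linarith

theorem eventually_guessableRates_bounds_of_pos (hδ : δ ∈ Set.Ioo (0 : ℝ) 1)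
    (hε : ε ∈ Set.Ioo (0 : ℝ) 1) (h : δ < 1 / 2 ∨ δ = 1 / 2 ∧ 1 / 2 ≤ ε) :
    ∃ K, ∀ᶠ n : ℕ in atTop,
      (∃ r ∈ (erasureNoise n δ (Set.Ioo_subset_Icc_self hδ)).guessableRates ε,
        secondOrderRate δ ε n - K * (1 / n) ≤ r) ∧
      ∀ r ∈ (erasureNoise n δ (Set.Ioo_subset_Icc_self hδ)).guessableRates ε,
        r ≤ secondOrderRate δ ε n + K * (1 / n) := by
  obtain ⟨K, hK⟩ := exists_eventually_exists_guessable_rate_ge hδ hε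
  obtain ⟨L, hL⟩ := exists_eventually_guessable_rate_le hδ hε
  have exists_rate : ∀ᶠ n : ℕ in atTop,
      ∃ r ∈ (erasureNoise n δ (Set.Ioo_subset_Icc_self hδ)).guessableRates ε,
        secondOrderRate δ ε n - (K + 1) * (1 / n) ≤ r := by
    rcases h with hlt | ⟨rfl, hhalf⟩
    · have hlim := tendsto_mul_natCast_add_mul_sqrt_atTop (c := 1 - 2 * δ) (by linarith)
        (2 * normalCDFInv ε * √(δ * (1 - δ)))
      filter_upwards [hK, hlim.eventually_ge_atTop K] with n hn hge
      exact hn (hge.trans_eq (natCast_mul_secondOrderRate δ ε n).symm)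
    · filter_upwards [hK, eventually_gt_atTop 0] with n hK hn
      by_cases hge : K ≤ n * secondOrderRate (1 / 2) ε n
      · exact hK hge
      · refine ⟨_, mem_guessableRates_erasureNoise _ n.zero_le <|
          (binomialMean_half_le_half fun _ => achievabilityTerm_add_reflect_le).trans hhalf, ?_⟩
        rw [Nat.cast_zero, zero_div, sub_nonpos, mul_one_div, le_div_iff₀' (Nat.cast_pos.2 hn)]
        linarith
  refine ⟨max (K + 1) L, ?_⟩
  filter_upwards [exists_rate, hL] with n ⟨r, hr, hle⟩ hL
  refine ⟨⟨r, hr, le_trans (by gcongr; exact le_max_left ..) hle⟩, fun r hr => (hL r hr).trans ?_⟩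
  gcongr
  exact le_max_right ..

theorem one_mem_guessableRates_erasureNoise_zero {n : ℕ} (hn : n ≠ 0)
    (hδ : (0 : ℝ) ∈ Set.Icc (0 : ℝ) 1) (hε : 0 ≤ ε) :
    1 ∈ (erasureNoise n 0 hδ).guessableRates ε := by
  rw [← div_self (Nat.cast_ne_zero.2 hn : (n : ℝ) ≠ 0)]
  refine mem_guessableRates_erasureNoise hδ le_rfl ?_
  rw [binomialMean_zero_right]
  simpa [achievabilityTerm] using hε

theorem eventually_guessableRates_bounds (hδ : δ ∈ Set.Icc (0 : ℝ) 1)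
    (hε : ε ∈ Set.Ioo (0 : ℝ) 1) (h : δ < 1 / 2 ∨ δ = 1 / 2 ∧ 1 / 2 ≤ ε) :
    ∃ K, ∀ᶠ n : ℕ in atTop,
      (∃ r ∈ (erasureNoise n δ hδ).guessableRates ε,
        secondOrderRate δ ε n - K * (1 / n) ≤ r) ∧
      ∀ r ∈ (erasureNoise n δ hδ).guessableRates ε,
        r ≤ secondOrderRate δ ε n + K * (1 / n) := by
  rcases hδ.1.eq_or_lt with rfl | hpos
  · refine ⟨0, (eventually_ne_atTop 0).mono fun n hn => ?_⟩
    have rate_eq : secondOrderRate 0 ε n = 1 := by simp [secondOrderRate]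
    simp only [rate_eq, zero_mul, sub_zero, add_zero]
    refine ⟨⟨1, one_mem_guessableRates_erasureNoise_zero hn hδ hε.1.le, le_rfl⟩, ?_⟩
    rintro r ⟨k, hk, rfl, -⟩
    exact div_le_one_of_le₀ (Nat.cast_le.2 hk) n.cast_nonneg
  · exact eventually_guessableRates_bounds_of_pos ⟨hpos, by rcases h with h | h <;> linarith⟩ hε h

theorem eventually_isGreatest_errorGuessRate_erasureNoise (hδ : δ ∈ Set.Icc (0 : ℝ) 1)
    (hε : ε ∈ Set.Ioo (0 : ℝ) 1) (h : δ < 1 / 2 ∨ δ = 1 / 2 ∧ 1 / 2 ≤ ε) :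
    ∀ᶠ n : ℕ in atTop, IsGreatest ((erasureNoise n δ hδ).guessableRates ε)
      ((erasureNoise n δ hδ).errorGuessRate ε) := by
  obtain ⟨K, hK⟩ := eventually_guessableRates_bounds hδ hε h
  exact hK.mono fun n hn => PauliNoise.isGreatest_errorGuessRate (hn.1.imp fun _ => And.left)

theorem errorGuessRate_sub_secondOrderRate_isBigO (hδ : δ ∈ Set.Icc (0 : ℝ) 1)
    (hε : ε ∈ Set.Ioo (0 : ℝ) 1) (h : δ < 1 / 2 ∨ δ = 1 / 2 ∧ 1 / 2 ≤ ε) :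
    (fun n : ℕ => (erasureNoise n δ hδ).errorGuessRate ε - secondOrderRate δ ε n)
      =O[atTop] fun n : ℕ => 1 / (n : ℝ) := by
  obtain ⟨K, hK⟩ := eventually_guessableRates_bounds hδ hε h
  refine IsBigO.of_bound K ?_
  filter_upwards [hK, eventually_isGreatest_errorGuessRate_erasureNoise hδ hε h]
    with n ⟨⟨r, hr, le_r⟩, upper⟩ greatest
  rw [Real.norm_eq_abs, Real.norm_of_nonneg (by positivity), abs_le]
  constructor <;> linarith [upper _ greatest.1, greatest.2 hr]

end OptimalRate

theorem mainTheorem5 (δ : ℝ) (hδ : δ ∈ Set.Icc (0 : ℝ) 1) :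
    (∀ (n k : ℕ), k ≤ n →
      ∀ ord : (Fin n → ZMod 2) → Fin (2 ^ (2 * n)) ≃ PauliVec n,
      (erasureNoise n δ hδ).IsSorting ord →
      ∀ m : ℕ, m = n - k →
      (erasureNoise n δ hδ).converseBound ord k =
          binomialCDF n (1 - δ) ((n : ℤ) - (m / 2 : ℕ) - 1)
          - 2 ^ m * ((4 - 3 * δ) / 4) ^ n *
            binomialCDF n ((4 - 4 * δ) / (4 - 3 * δ)) ((n : ℤ) - (m / 2 : ℕ) - 1) ∧
      (erasureNoise n δ hδ).achievabilityBound ord k =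
          (1 + 1 / 2 ^ (m + 1)) * binomialCDF n (1 - δ) ((n : ℤ) - (m / 2 : ℕ) - 1)
          - 1 / 2 ^ (m + 1)
          - (2 ^ m + 1) / 2 * ((4 - 3 * δ) / 4) ^ n *
            binomialCDF n ((4 - 4 * δ) / (4 - 3 * δ)) ((n : ℤ) - (m / 2 : ℕ) - 1)
          + (1 + 3 * δ) ^ n / 2 ^ (m + 1) *
            binomialCDF n (4 * δ / (1 + 3 * δ)) ((m / 2 : ℕ) : ℤ)) ∧
    (∀ ε : ℝ, ε ∈ Set.Ioo (0 : ℝ) 1 → (δ < 1 / 2 ∨ δ = 1 / 2 ∧ 1 / 2 ≤ ε) →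
      (∀ᶠ n : ℕ in atTop, IsGreatest ((erasureNoise n δ hδ).guessableRates ε)
        ((erasureNoise n δ hδ).errorGuessRate ε)) ∧
      (fun n : ℕ => (erasureNoise n δ hδ).errorGuessRate ε -
          (1 - 2 * δ + 2 * normalCDFInv ε * √(δ * (1 - δ)) / √(n : ℝ)))
        =O[atTop] fun n : ℕ => 1 / (n : ℝ)) := by
  refine ⟨fun n k _ ord hord m hm => ?_, fun ε hε h =>
    ⟨eventually_isGreatest_errorGuessRate_erasureNoise hδ hε h,
      errorGuessRate_sub_secondOrderRate_isBigO hδ hε h⟩⟩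
  subst hm
  exact ⟨(erasureNoise_converseBound hδ hord k).trans (binomialMean_converseTerm n _ hδ.2),
    (erasureNoise_achievabilityBound hδ hord k).trans (binomialMean_achievabilityTerm n _ hδ)⟩
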